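/- Let $\omega_1>0$ and $\omega_0\ge 0$. Consider the infinite harmonic chain $$\ddot q_k=-\omega_0^2q_k+\omega_1^2(q_{k+1}-q_k)-\omega_1^2(q_k-q_{k-1}),\qquad k\in\mathbb Z,\ t\ge 0,$$ with initial data $q(0)=(q_k(0))_{k\in\mathbb Z}\in l_2(\mathbb Z)$ and $p(0)=(p_k(0))_{k\in\mathbb Z}\in l_2(\mathbb Z)$, where $p_k=\dot q_k$. Solutions are real and understood in $l_2(\mathbb Z)$, that is, $q(t),p(t)\in l_2(\mathbb Z)$ for all $t\ge 0$ (for given initial data there is exactly one such solution). Put $M(t)=\sup_{k\in\mathbb Z}|q_k(t)|$ and let $\|\cdot\|_2$ be the norm of $l_2(\mathbb Z)$. The following assertions hold. 1. If $\omega_0>0$, then $\sup_{t\ge 0}M(t)<\infty$. 2. If $\omega_0=0$, then: (a) For all $t\ge 0$, $$M(t)\le\frac{2}{\sqrt{\omega_1}}\,\|p(0)\|_2\,\sqrt t+\|q(0)\|_2 .$$ (b) Suppose that $\sum_{k\ne 0}|p_k(0)|\ln|k|<\infty$. Then the series $P=\sum_{k}p_k(0)$ converges absolutely and there is a constant $c>0$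 such that for all $t\ge 1$ $$M(t)\le\frac{\sqrt 2}{\omega_1\pi}\,|P|\ln t+\|q(0)\|_2+c .$$ (c) For every $\delta>1/2$ there exists at least one initial condition with $q(0)=0$ and $p(0)\in l_2(\mathbb Z)$ such that the corresponding solution satisfies $$\lim_{t\to\infty}\frac{q_0(t)}{\sqrt t}\,\ln^{\delta}t=\frac{\Gamma(\delta)}{\sqrt{2\omega_1}}>0,$$ where $\Gamma$ is the gamma function. -/

import Mathlib

open Filter Topology
open scoped ENNReal

namespace HarmonicChain

/-- The real Hilbert space `l₂(ℤ)` of square summable two-sided real sequences. -/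
abbrev L2Z : Type := lp (fun _ : ℤ => ℝ) 2

/-- The force acting on the particle `k` of the chain when the deviations are `u`:
`-ω₀² u_k + ω₁² (u_{k+1} - u_k) - ω₁² (u_k - u_{k-1})`. -/
def force (ω₀ ω₁ : ℝ) (u : ℤ → ℝ) (k : ℤ) : ℝ :=
  -ω₀ ^ 2 * u k + ω₁ ^ 2 * (u (k + 1) - u k) - ω₁ ^ 2 * (u k - u (k - 1))

/-- `(q(t), p(t))`, `t ≥ 0`, is an `l₂(ℤ)` solution of the infinite harmonic chain: the sequences
`q(t)` and `p(t)` lie in `l₂(ℤ)`, and for every particle `k` and every `t ≥ 0` one has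
`q_k' = p_k` and `p_k' = force_k(q)`. Derivatives are taken coordinate by coordinate, on
`[0, ∞)` (so one-sided at `t = 0`); values at negative times play no role. -/
structure IsSolution (ω₀ ω₁ : ℝ) (q p : ℝ → L2Z) : Prop where
  deriv_q : ∀ t : ℝ, 0 ≤ t → ∀ k : ℤ,
    HasDerivWithinAt (fun s : ℝ => q s k) (p t k) (Set.Ici 0) t
  deriv_p : ∀ t : ℝ, 0 ≤ t → ∀ k : ℤ,
    HasDerivWithinAt (fun s : ℝ => p s k) (force ω₀ ω₁ (q t) k) (Set.Ici 0) t

/-- The max-norm `M = sup_k |u_k|` of a sequence, with values in `[0, ∞]`. -/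
noncomputable def maxNorm (u : ℤ → ℝ) : ℝ≥0∞ := ⨆ k : ℤ, ENNReal.ofReal |u k|

end HarmonicChain

/-! The chain is a linear equation with a bounded generator on `l₂ × l₂`, so an exponential group
solves it and conserves energy. With pinning, the energy controls `ω₀² ‖q‖²`, which is assertion 1.
Without pinning, the flow started from `(q(0), 0)` has as its position the velocity of the flow
started from `(0, q(0))`; energy bounds this by `‖q(0)‖`, and only the response to `p(0)` can grow.

(a) For that response `‖q‖ ≤ t ‖p(0)‖` and `ω₁ ‖Tq - q‖ ≤ ‖p(0)‖`, with `T` the shift, and the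
interpolation `u_n² ≤ 2 ‖u‖ ‖Tu - u‖` (`sq_apply_le`) yields `√t`.

(b) A unit impulse produces `1/(ω₁π) ∫ sin(2ω₁t sin θ) / sin θ · cos(2mθ) dθ` over `(0, π/2)`. The
pole at 0 is smoothed at scale `1/t`, which costs `log t`; moving the source by `k` costs only `O(1
+ log |k|)`, uniformly in time. Hence all sources may be moved to the origin, where they add up to
`P`.

(c) The profile `θ^(-1/2) (1 - log θ)^(-δ)` lies in `L²` because `δ > 1/2`. After the substitution
`u = 2ω₁tθ`, dominated convergence gives a multiple of `√t / log^δ t` with constant `∫ u^(-1/2) sinc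
u du > 0`; a scalar adjusts the limit.

Every solution must be identified with the group, although solutions are differentiable only
coordinatewise and their norms are not assumed locally bounded in time. Gronwall with finite weights
proves uniqueness once the norm is locally bounded, and Baire category supplies that bound. -/

namespace HarmonicChain

/-! ### Square summable sequences and the shift -/

theorem summable_sq_apply (u : L2Z) : Summable (fun k => u k ^ 2) := by
  have h := (lp.memℓp u).summable (by norm_num)
  simpa using h

theorem hasSum_sq_apply (u : L2Z) : HasSum (fun k => u k ^ 2) (‖u‖ ^ 2) := by
  have h := lp.hasSum_norm (p := 2) (by norm_num) u
  simpa using h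

theorem tsum_sq_apply (u : L2Z) : ∑' k, u k ^ 2 = ‖u‖ ^ 2 := (hasSum_sq_apply u).tsum_eq

theorem memLp_two_of_summable_sq {f : ℤ → ℝ} (h : Summable fun k => f k ^ 2) :
    Memℓp f 2 :=
  memℓp_gen (by simpa using h)

theorem abs_apply_le_norm (u : L2Z) (k : ℤ) : |u k| ≤ ‖u‖ := by
  simpa using lp.norm_apply_le_norm (by norm_num) u k

/-- Reindexing of a two-sided square summable sequence along a bijection of `ℤ`. -/
noncomputable def reindex (e : ℤ ≃ ℤ) : L2Z ≃ₗᵢ[ℝ] L2Z where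
  toFun u := ⟨fun k => u (e k), memLp_two_of_summable_sq
    (by simpa [Function.comp_def] using (e.summable_iff (f := fun k => u k ^ 2)).2 (summable_sq_apply u))⟩
  invFun u := ⟨fun k => u (e.symm k), memLp_two_of_summable_sq
    (by simpa [Function.comp_def] using
      (e.symm.summable_iff (f := fun k => u k ^ 2)).2 (summable_sq_apply u))⟩
  map_add' u v := rfl
  map_smul' c u := by ext k; simp
  left_inv u := by ext k; simp
  right_inv u := by ext k; simp
  norm_map' u := by
    have h1 := hasSum_sq_apply (⟨fun k => u (e k), memLp_two_of_summable_sq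
      (by simpa [Function.comp_def] using
        (e.summable_iff (f := fun k => u k ^ 2)).2 (summable_sq_apply u))⟩ : L2Z)
    have h2 := (e.hasSum_iff (f := fun k => u k ^ 2)).2 (hasSum_sq_apply u)
    have h3 := h1.unique h2
    exact (pow_left_inj₀ (norm_nonneg _) (norm_nonneg _) two_ne_zero).1 h3

/-- The shift `(T u)_k = u_{k+1}`. -/
noncomputable def shift : L2Z ≃ₗᵢ[ℝ] L2Z := reindex (Equiv.addRight 1)

@[simp] theorem shift_apply (u : L2Z) (k : ℤ) : shift u k = u (k + 1) := rfl

@[simp] theorem shift_symm_apply (u : L2Z) (k : ℤ) : shift.symm u k = u (k - 1) := by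
  have h : shift (shift.symm u) (k - 1) = u (k - 1) := by rw [LinearIsometryEquiv.apply_symm_apply]
  rw [← h, shift_apply]; simp

/-! ### The generator and its group -/

/-- The force as a bounded operator. -/
noncomputable def forceOp (ω₀ ω₁ : ℝ) : L2Z →L[ℝ] L2Z :=
  (-ω₀ ^ 2) • ContinuousLinearMap.id ℝ L2Z +
    ω₁ ^ 2 • ((shift : L2Z →L[ℝ] L2Z) + (shift.symm : L2Z →L[ℝ] L2Z)
      - (2 : ℝ) • ContinuousLinearMap.id ℝ L2Z)

theorem forceOp_eq (ω₀ ω₁ : ℝ) (u : L2Z) :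
    forceOp ω₀ ω₁ u = (-ω₀ ^ 2) • u + ω₁ ^ 2 • (shift u + shift.symm u - (2 : ℝ) • u) := rfl

theorem forceOp_apply (ω₀ ω₁ : ℝ) (u : L2Z) (k : ℤ) :
    forceOp ω₀ ω₁ u k = force ω₀ ω₁ u k := by
  rw [forceOp_eq]
  simp only [lp.coeFn_add, lp.coeFn_smul, lp.coeFn_sub, Pi.add_apply, Pi.smul_apply, Pi.sub_apply,
    shift_apply, shift_symm_apply, smul_eq_mul, force]
  ring

/-- The generator of the chain dynamics on the phase space. -/
noncomputable def generator (ω₀ ω₁ : ℝ) : (L2Z × L2Z) →L[ℝ] (L2Z × L2Z) :=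
  (ContinuousLinearMap.snd ℝ L2Z L2Z).prod ((forceOp ω₀ ω₁).comp (ContinuousLinearMap.fst ℝ L2Z L2Z))

/-- The one-parameter group of the chain dynamics. -/
noncomputable def flow (ω₀ ω₁ t : ℝ) : (L2Z × L2Z) →L[ℝ] (L2Z × L2Z) :=
  NormedSpace.exp (t • generator ω₀ ω₁)

@[simp] theorem flow_zero (ω₀ ω₁ : ℝ) (x : L2Z × L2Z) : flow ω₀ ω₁ 0 x = x := by
  simp [flow]

theorem hasDerivAt_flow (ω₀ ω₁ t : ℝ) (x : L2Z × L2Z) :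
    HasDerivAt (fun s => flow ω₀ ω₁ s x) (generator ω₀ ω₁ (flow ω₀ ω₁ t x)) t := by
  have h := hasDerivAt_exp_smul_const' (generator ω₀ ω₁) t
  exact (((ContinuousLinearMap.apply ℝ (L2Z × L2Z) x).hasFDerivAt).comp_hasDerivAt t h)

theorem hasDerivAt_flow_fst (ω₀ ω₁ t : ℝ) (x : L2Z × L2Z) :
    HasDerivAt (fun s => (flow ω₀ ω₁ s x).1) (flow ω₀ ω₁ t x).2 t :=
  (ContinuousLinearMap.fst ℝ L2Z L2Z).hasFDerivAt.comp_hasDerivAt t (hasDerivAt_flow ω₀ ω₁ t x)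

theorem hasDerivAt_flow_snd (ω₀ ω₁ t : ℝ) (x : L2Z × L2Z) :
    HasDerivAt (fun s => (flow ω₀ ω₁ s x).2) (forceOp ω₀ ω₁ (flow ω₀ ω₁ t x).1) t :=
  (ContinuousLinearMap.snd ℝ L2Z L2Z).hasFDerivAt.comp_hasDerivAt t (hasDerivAt_flow ω₀ ω₁ t x)

theorem isSolution_flow (ω₀ ω₁ : ℝ) (x : L2Z × L2Z) :
    IsSolution ω₀ ω₁ (fun t => (flow ω₀ ω₁ t x).1) (fun t => (flow ω₀ ω₁ t x).2) where
  deriv_q t _ k := ((lp.evalCLM ℝ (fun _ : ℤ => ℝ) 2 k).hasFDerivAt.comp_hasDerivAt t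
    (hasDerivAt_flow_fst ω₀ ω₁ t x)).hasDerivWithinAt
  deriv_p t _ k := by
    rw [← forceOp_apply]
    exact ((lp.evalCLM ℝ (fun _ : ℤ => ℝ) 2 k).hasFDerivAt.comp_hasDerivAt t
      (hasDerivAt_flow_snd ω₀ ω₁ t x)).hasDerivWithinAt

/-! ### Conservation of energy and interpolation -/

/-- Twice the energy of a state. -/
noncomputable def energy (ω₀ ω₁ : ℝ) (x : L2Z × L2Z) : ℝ :=
  ‖x.2‖ ^ 2 + ω₀ ^ 2 * ‖x.1‖ ^ 2 + ω₁ ^ 2 * ‖shift x.1 - x.1‖ ^ 2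

theorem energy_flow (ω₀ ω₁ t : ℝ) (x : L2Z × L2Z) :
    energy ω₀ ω₁ (flow ω₀ ω₁ t x) = energy ω₀ ω₁ x := by
  have key : ∀ t, HasDerivAt (fun s => energy ω₀ ω₁ (flow ω₀ ω₁ s x)) 0 t := by
    intro t
    have h1 := hasDerivAt_flow_fst ω₀ ω₁ t x
    have h2 := hasDerivAt_flow_snd ω₀ ω₁ t x
    have h3 : HasDerivAt (fun s => shift (flow ω₀ ω₁ s x).1 - (flow ω₀ ω₁ s x).1)
        (shift (flow ω₀ ω₁ t x).2 - (flow ω₀ ω₁ t x).2) t :=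
      ((shift : L2Z →L[ℝ] L2Z).hasFDerivAt.comp_hasDerivAt t h1).sub h1
    have h := (h2.norm_sq.add (h1.norm_sq.const_mul (ω₀ ^ 2))).add (h3.norm_sq.const_mul (ω₁ ^ 2))
    refine h.congr_deriv ?_
    generalize (flow ω₀ ω₁ t x).1 = q
    generalize (flow ω₀ ω₁ t x).2 = p
    -- Summation by parts: the adjoint of the shift is its inverse, so the coupling terms cancel.
    have hs : inner ℝ p (shift.symm q) = inner ℝ (shift p) q := by
      rw [← LinearIsometryEquiv.inner_map_map shift, LinearIsometryEquiv.apply_symm_apply]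
    rw [forceOp_eq]
    simp only [inner_add_right, inner_sub_right, inner_smul_right, inner_sub_left, hs,
      LinearIsometryEquiv.inner_map_map]
    rw [real_inner_comm p q, real_inner_comm p (shift q), real_inner_comm (shift p) q]
    ring
  have h := is_const_of_deriv_eq_zero (fun t => (key t).differentiableAt) (fun t => (key t).deriv) t 0
  simpa using h

theorem norm_sq_snd_le_energy (ω₀ ω₁ : ℝ) (x : L2Z × L2Z) : ‖x.2‖ ^ 2 ≤ energy ω₀ ω₁ x := by
  unfold energy
  have := sq_nonneg (ω₀ * ‖x.1‖)
  have := sq_nonneg (ω₁ * ‖shift x.1 - x.1‖)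
  nlinarith

theorem norm_flow_snd_le (ω₁ t : ℝ) (y : L2Z) :
    ‖(flow 0 ω₁ t (0, y)).2‖ ≤ ‖y‖ := by
  have h := norm_sq_snd_le_energy 0 ω₁ (flow 0 ω₁ t (0, y))
  rw [energy_flow] at h
  simp only [energy, map_zero] at h
  exact abs_le_of_sq_le_sq' (by simpa using h) (norm_nonneg _) |>.2

theorem norm_flow_fst_le (ω₁ : ℝ) {t : ℝ} (ht : 0 ≤ t) (y : L2Z) :
    ‖(flow 0 ω₁ t (0, y)).1‖ ≤ ‖y‖ * t := by
  have h := norm_image_sub_le_of_norm_deriv_le_segment'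
    (f := fun s => (flow 0 ω₁ s (0, y)).1) (f' := fun s => (flow 0 ω₁ s (0, y)).2) (a := 0) (b := t)
    (C := ‖y‖) (fun s _ => (hasDerivAt_flow_fst 0 ω₁ s (0, y)).hasDerivWithinAt)
    (fun s _ => norm_flow_snd_le ω₁ s y) t ⟨ht, le_rfl⟩
  simpa using h

theorem norm_shift_sub_flow_fst_le (ω₁ t : ℝ) (y : L2Z) :
    ω₁ * ‖shift (flow 0 ω₁ t (0, y)).1 - (flow 0 ω₁ t (0, y)).1‖ ≤ ‖y‖ := by
  have h := energy_flow 0 ω₁ t (0, y)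
  simp only [energy, map_zero] at h
  refine abs_le_of_sq_le_sq' ?_ (norm_nonneg _) |>.2
  simp at h
  nlinarith [sq_nonneg ‖(flow 0 ω₁ t (0, y)).2‖]

/-- The dynamics of an initial deviation is the velocity of the dynamics of an initial velocity. -/
theorem flow_fst_eq_flow_snd (ω₀ ω₁ t : ℝ) (y : L2Z) :
    (flow ω₀ ω₁ t (y, 0)).1 = (flow ω₀ ω₁ t (0, y)).2 := by
  have h : (y, (0 : L2Z)) = generator ω₀ ω₁ (0, y) := by
    simp [generator]
  have hc : flow ω₀ ω₁ t (generator ω₀ ω₁ (0, y)) = generator ω₀ ω₁ (flow ω₀ ω₁ t (0, y)) := by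
    have : Commute (NormedSpace.exp (t • generator ω₀ ω₁)) (generator ω₀ ω₁) :=
      ((Commute.refl (generator ω₀ ω₁)).smul_left t).exp_left
    exact congrArg (fun f => f (0, y)) this.eq
  rw [h, hc]
  rfl

/-- A discrete interpolation inequality. -/
theorem sq_apply_le (u : L2Z) (n : ℤ) : u n ^ 2 ≤ 2 * ‖u‖ * ‖shift u - u‖ := by
  -- Telescope `a² - b² = (a + b)(a - b)` and apply Cauchy–Schwarz; the 2 comes from `‖Tu + u‖ ≤ 2
  -- ‖u‖`. The far endpoint vanishes as `N → ∞`.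
  have hbound : ∀ N : ℕ, u n ^ 2 - u (n + N) ^ 2 ≤ 2 * ‖u‖ * ‖shift u - u‖ := by
    intro N
    have htel : u n ^ 2 - u (n + N) ^ 2
        = ∑ j ∈ Finset.range N, (u (n + j) ^ 2 - u (n + (j + 1 : ℕ)) ^ 2) := by
      rw [Finset.sum_range_sub']
      simp
    have hnorm : ‖shift u + u‖ ≤ 2 * ‖u‖ := by
      calc _ ≤ ‖shift u‖ + ‖u‖ := norm_add_le _ _
        _ = _ := by rw [LinearIsometryEquiv.norm_map]; ring
    have hinj : Function.Injective (fun j : ℕ => n + (j : ℤ)) := by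
      intro a b h; simpa using h
    have hle : ∀ v : L2Z, ∑ j ∈ Finset.range N, v (n + j) ^ 2 ≤ ‖v‖ ^ 2 := by
      intro v
      have := sum_le_hasSum ((Finset.range N).map ⟨_, hinj⟩) (fun k _ => sq_nonneg (v k))
        (hasSum_sq_apply v)
      simpa using this
    have hcs := Finset.sum_mul_sq_le_sq_mul_sq (Finset.range N)
      (fun j => (shift u + u) (n + (j : ℤ))) (fun j => (shift u - u) (n + (j : ℤ)))
    have hprod : (∑ j ∈ Finset.range N, (u (n + j) ^ 2 - u (n + (j + 1 : ℕ)) ^ 2)) ^ 2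
        ≤ (2 * ‖u‖ * ‖shift u - u‖) ^ 2 := by
      calc _ = (∑ j ∈ Finset.range N,
            (shift u + u) (n + (j : ℤ)) * (shift u - u) (n + (j : ℤ))) ^ 2 := by
            rw [← neg_sq, ← Finset.sum_neg_distrib]
            congr 1
            refine Finset.sum_congr rfl fun j _ => ?_
            simp only [lp.coeFn_add, lp.coeFn_sub, Pi.add_apply, Pi.sub_apply, shift_apply]
            push_cast
            rw [← add_assoc]
            ring
        _ ≤ _ := hcs
        _ ≤ ‖shift u + u‖ ^ 2 * ‖shift u - u‖ ^ 2 :=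
            mul_le_mul (hle _) (hle _) (Finset.sum_nonneg fun _ _ => sq_nonneg _) (sq_nonneg _)
        _ ≤ _ := by
            rw [← mul_pow]
            gcongr
    rw [htel]
    exact (abs_le_of_sq_le_sq' hprod (by positivity)).2
  have hlim : Tendsto (fun N : ℕ => u n ^ 2 - u (n + N) ^ 2) atTop (𝓝 (u n ^ 2 - 0)) := by
    refine Tendsto.const_sub _ ?_
    have hinj : Function.Injective (fun j : ℕ => n + (j : ℤ)) := by
      intro a b h; simpa using h
    exact ((summable_sq_apply u).comp_injective hinj).tendsto_atTop_zero
  simpa using le_of_tendsto' hlim hbound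

/-! ### Local boundedness by Baire category -/

section LocallyBounded

variable {ψ : ℝ → ℝ} {C : ℝ}

theorem bddAbove_image_Icc_of_forall_eventually_le {a b : ℝ}
    (h : ∀ t ∈ Set.Icc a b, ∃ N, ∀ᶠ s in 𝓝 t, ψ s ≤ N) : BddAbove (ψ '' Set.Icc a b) := by
  refine isCompact_Icc.induction_on (p := fun s => BddAbove (ψ '' s)) (by simp)
    (fun s t hst ht => ht.mono (Set.image_mono hst))
    (fun s t hs ht => by rw [Set.image_union]; exact hs.union ht) ?_
  intro t ht
  obtain ⟨N, hN⟩ := h t ht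
  refine ⟨{s | ψ s ≤ N}, mem_nhdsWithin_of_mem_nhds hN, N, ?_⟩
  rintro _ ⟨s, hs, rfl⟩
  exact hs

/-- The a priori estimate `hg` is available only on intervals where `ψ` is already bounded, and
nothing is known near `s`. Running it forward from `t` bounds `ψ` on `[t, s)` uniformly; the single
value `ψ s` then makes `[t, s]` admissible, and the estimate can be run backward from `s`. -/
theorem le_exp_mul_of_forall_Ico {t s : ℝ}
    (hC : 0 ≤ C) (hψ : ∀ x, 0 ≤ ψ x)
    (hg : ∀ a b, BddAbove (ψ '' Set.Icc a b) → ∀ x ∈ Set.Icc a b, ∀ y ∈ Set.Icc a b,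
      ψ x ≤ Real.exp (C * |x - y|) * ψ y)
    (hts : t < s) (hloc : ∀ y ∈ Set.Ico t s, ∃ N, ∀ᶠ r in 𝓝 y, ψ r ≤ N) :
    ψ t ≤ Real.exp (C * (s - t)) * ψ s := by
  have hb : ∀ r ∈ Set.Ico t s, ψ r ≤ Real.exp (C * (s - t)) * ψ t := by
    intro r hr
    have h1 : BddAbove (ψ '' Set.Icc t r) :=
      bddAbove_image_Icc_of_forall_eventually_le fun y hy => hloc y ⟨hy.1, hy.2.trans_lt hr.2⟩
    refine (hg t r h1 r ⟨hr.1, le_rfl⟩ t ⟨le_rfl, hr.1⟩).trans ?_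
    have : |r - t| ≤ s - t := by rw [abs_of_nonneg (by linarith [hr.1])]; linarith [hr.2]
    gcongr
    exact hψ t
  have hbdd : BddAbove (ψ '' Set.Icc t s) := by
    refine ⟨max (Real.exp (C * (s - t)) * ψ t) (ψ s), ?_⟩
    rintro _ ⟨r, hr, rfl⟩
    rcases hr.2.lt_or_eq with h | h
    · exact (hb r ⟨hr.1, h⟩).trans (le_max_left _ _)
    · rw [h]; exact le_max_right _ _
  have := hg t s hbdd t ⟨le_rfl, hts.le⟩ s ⟨hts.le, le_rfl⟩
  rwa [abs_sub_comm, abs_of_pos (by linarith)] at this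

/-- The backward step towards a point of a closed set off which `ψ` is locally bounded. -/
theorem le_exp_mul_of_bound_on_closed {F : Set ℝ} (hF : IsClosed F)
    (hloc : ∀ y ∉ F, ∃ N, ∀ᶠ r in 𝓝 y, ψ r ≤ N)
    (hC : 0 ≤ C) (hψ : ∀ x, 0 ≤ ψ x)
    (hg : ∀ a b, BddAbove (ψ '' Set.Icc a b) → ∀ x ∈ Set.Icc a b, ∀ y ∈ Set.Icc a b,
      ψ x ≤ Real.exp (C * |x - y|) * ψ y)
    {t x N ε : ℝ} (hx : x ∈ F) (htx : t ≤ x) (hε : x - t ≤ ε)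
    (hN : ∀ y ∈ F, t ≤ y → y ≤ x → ψ y ≤ N) :
    ψ t ≤ Real.exp (C * ε) * N := by
  have hN0 : 0 ≤ N := (hψ x).trans (hN x hx htx le_rfl)
  by_cases ht : t ∈ F
  · calc ψ t ≤ 1 * N := by rw [one_mul]; exact hN t ht le_rfl htx
      _ ≤ _ := by
        gcongr
        exact Real.one_le_exp (mul_nonneg hC (by linarith))
  · have hcl : IsClosed (F ∩ Set.Icc t x) := hF.inter isClosed_Icc
    have hbb : BddBelow (F ∩ Set.Icc t x) := ⟨t, fun y hy => hy.2.1⟩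
    have hs := hcl.csInf_mem ⟨x, hx, htx, le_rfl⟩ hbb
    -- The first point of `F` to the right of `t`: the gap `[t, s)` avoids `F`, so the bound at `s`
    -- propagates back to `t`.
    set s := sInf (F ∩ Set.Icc t x) with hsdef
    have hts : t < s := lt_of_le_of_ne hs.2.1 (fun h => ht (h ▸ hs.1))
    have h := le_exp_mul_of_forall_Ico hC hψ hg hts (fun y hy => hloc y fun hyF =>
      absurd (csInf_le hbb ⟨hyF, hy.1, hy.2.le.trans hs.2.2⟩) (not_le.2 hy.2))
    refine h.trans ?_
    have h1 := hN s hs.1 hs.2.1 hs.2.2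
    have h2 : s - t ≤ ε := by linarith [hs.2.2]
    have h3 := hψ s
    gcongr

/-- The points near which `ψ` is unbounded form a closed set `F`. If it were nonempty, Baire would
give a point of `F` near which `ψ ≤ N` on `F`. The exponential estimate carries this bound across
the gaps of `F`, so `ψ` would be bounded near that point, a contradiction. -/
theorem eventually_le_of_forall_exp_bound (hC : 0 ≤ C) (hψ : ∀ x, 0 ≤ ψ x)
    (hclosed : ∀ N : ℕ, IsClosed {t | ψ t ≤ N})
    (hg : ∀ a b, BddAbove (ψ '' Set.Icc a b) → ∀ x ∈ Set.Icc a b, ∀ y ∈ Set.Icc a b,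
      ψ x ≤ Real.exp (C * |x - y|) * ψ y) (t : ℝ) :
    ∃ N, ∀ᶠ s in 𝓝 t, ψ s ≤ N := by
  by_contra ht
  set F : Set ℝ := {t | ¬ ∃ N, ∀ᶠ s in 𝓝 t, ψ s ≤ N} with hFdef
  have hF : IsClosed F := by
    rw [← isOpen_compl_iff, isOpen_iff_mem_nhds]
    intro y hy
    obtain ⟨N, hN⟩ := not_not.1 hy
    filter_upwards [eventually_eventually_nhds.2 hN] with z hz
    exact not_not.2 ⟨N, hz⟩
  have hloc : ∀ y ∉ F, ∃ N, ∀ᶠ r in 𝓝 y, ψ r ≤ N := fun y hy => not_not.1 hy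
  have : Nonempty F := ⟨⟨t, ht⟩⟩
  have : CompleteSpace F := hF.completeSpace_coe
  obtain ⟨N, ⟨x, hx⟩⟩ := nonempty_interior_of_iUnion_of_closed
    (f := fun N : ℕ => {x : F | ψ x ≤ N})
    (fun N => (hclosed N).preimage continuous_subtype_val) (by
      ext x
      simpa using exists_nat_ge (ψ x))
  rw [mem_interior_iff_mem_nhds, Metric.mem_nhds_iff] at hx
  obtain ⟨ε, hε, hball⟩ := hx
  have hN : ∀ y ∈ F, |y - x| < ε → ψ y ≤ N := fun y hy hyx =>
    hball (show (⟨y, hy⟩ : F) ∈ Metric.ball x ε from by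
      rw [Metric.mem_ball, Subtype.dist_eq, Real.dist_eq]; exact hyx)
  refine x.2 ⟨Real.exp (C * ε) * N, ?_⟩
  filter_upwards [Metric.ball_mem_nhds (x : ℝ) hε] with s hs
  rw [Metric.mem_ball, Real.dist_eq] at hs
  have hs' := abs_lt.1 hs
  rcases le_total s x with h | h
  · refine le_exp_mul_of_bound_on_closed hF hloc hC hψ hg x.2 h (by linarith) ?_
    intro y hy h1 h2
    exact hN y hy (by rw [abs_lt]; constructor <;> linarith)
  -- To the right of `x`, reverse time; the hypotheses are symmetric.
  · have := le_exp_mul_of_bound_on_closed (ψ := fun r => ψ (-r)) (C := C) (F := Neg.neg ⁻¹' F)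
      (hF.preimage continuous_neg) (fun y hy => by
        obtain ⟨M, hM⟩ := hloc (-y) hy
        exact ⟨M, (continuous_neg.tendsto y).eventually hM⟩) hC (fun r => hψ _)
      (fun a b hab u hu v hv => by
        have := hg (-b) (-a) (by
          convert hab using 1
          ext z
          constructor
          · rintro ⟨w, hw, rfl⟩
            exact ⟨-w, ⟨by linarith [hw.2], by linarith [hw.1]⟩, by simp⟩
          · rintro ⟨w, hw, rfl⟩
            exact ⟨-w, ⟨by linarith [hw.2], by linarith [hw.1]⟩, by simp⟩)
          (-u) ⟨by linarith [hu.2], by linarith [hu.1]⟩ (-v)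
          ⟨by linarith [hv.2], by linarith [hv.1]⟩
        rwa [show -u - -v = -(u - v) by ring, abs_neg] at this)
      (t := -s) (x := -x) (N := N) (ε := ε) (by simp) (by linarith) (by linarith)
      (by
        intro y hy h1 h2
        exact hN (-y) hy (by rw [abs_lt]; constructor <;> linarith))
    simpa using this

end LocallyBounded

/-! ### Weighted estimates with tent cut-offs -/

/-- The tent weight of half-width `n`. -/
noncomputable def tent (n : ℕ) (k : ℤ) : ℝ := max 0 (1 - |(k : ℝ)| / n)

theorem tent_nonneg (n : ℕ) (k : ℤ) : 0 ≤ tent n k := le_max_left _ _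

theorem tent_le_one (n : ℕ) (k : ℤ) : tent n k ≤ 1 :=
  max_le zero_le_one (by linarith [show (0 : ℝ) ≤ |(k : ℝ)| / n by positivity])

/-- Positivity matters: division by zero makes the tent of half-width 0 identically 1. -/
theorem tent_eq_zero {n : ℕ} (hn : 0 < n) {k : ℤ} (hk : k ∉ Finset.Icc (-n : ℤ) n) :
    tent n k = 0 := by
  apply max_eq_left
  have hk' : (n : ℤ) ≤ |k| := by
    by_contra h
    push Not at h
    rw [abs_lt] at h
    exact hk (Finset.mem_Icc.2 ⟨h.1.le, h.2.le⟩)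
  have h2 : (n : ℝ) ≤ |(k : ℝ)| := by exact_mod_cast hk'
  have hn' : (0 : ℝ) < n := by exact_mod_cast hn
  rw [sub_nonpos, one_le_div hn']
  exact h2

/-- The slope `1 / n` is the reason for a tent: the coupling leaks at most `O(1/n) ‖u‖²` through it,
whereas the flux across a sharp cut-off has no such uniform small factor. -/
theorem tent_le_add {n : ℕ} {k l : ℤ} (hkl : |k - l| ≤ 1) :
    tent n k ≤ tent n l + 1 / n := by
  have h1 : |(k : ℝ) - l| ≤ 1 := by exact_mod_cast hkl
  have h2 : |(l : ℝ)| ≤ |(k : ℝ)| + 1 := by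
    have := abs_sub_abs_le_abs_sub (l : ℝ) k
    rw [abs_sub_comm] at this
    linarith
  have hn : (0 : ℝ) ≤ 1 / n := by positivity
  refine max_le (add_nonneg (tent_nonneg _ _) hn) ?_
  have h3 : |(l : ℝ)| / n ≤ |(k : ℝ)| / n + 1 / n := by
    rw [← add_div]; gcongr
  have h4 : 1 - |(l : ℝ)| / n ≤ tent n l := le_max_right _ _
  linarith

theorem tendsto_tent (k : ℤ) : Tendsto (fun n => tent n k) atTop (𝓝 1) := by
  have h : Tendsto (fun n : ℕ => max 0 (1 - |(k : ℝ)| / n)) atTop (𝓝 (max 0 (1 - 0))) :=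
    tendsto_const_nhds.max (tendsto_const_nhds.sub (tendsto_const_div_atTop_nhds_zero_nat _))
  simpa [tent] using h

theorem summable_tent_mul (n : ℕ) {f : ℤ → ℝ} (hf : Summable f) (hf0 : ∀ k, 0 ≤ f k) :
    Summable fun k => tent n k * f k :=
  Summable.of_nonneg_of_le (fun k => mul_nonneg (tent_nonneg _ _) (hf0 k))
    (fun k => mul_le_of_le_one_left (hf0 k) (tent_le_one _ _)) hf

theorem tsum_tent_mul_eq_sum {n : ℕ} (hn : 0 < n) (f : ℤ → ℝ) :
    ∑' k, tent n k * f k = ∑ k ∈ Finset.Icc (-n : ℤ) n, tent n k * f k :=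
  tsum_eq_sum fun k hk => by rw [tent_eq_zero hn hk, zero_mul]

theorem tendsto_tsum_tent_mul {f : ℤ → ℝ} (hf : Summable f) (hf0 : ∀ k, 0 ≤ f k) :
    Tendsto (fun n => ∑' k, tent n k * f k) atTop (𝓝 (∑' k, f k)) := by
  refine tendsto_tsum_of_dominated_convergence hf (fun k => ?_) (Eventually.of_forall fun n k => ?_)
  · simpa using (tendsto_tent k).mul_const (f k)
  · rw [Real.norm_of_nonneg (mul_nonneg (tent_nonneg _ _) (hf0 k))]
    exact mul_le_of_le_one_left (hf0 k) (tent_le_one _ _)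

theorem tsum_tent_mul_reindex_le (n : ℕ) (u : L2Z) (e : ℤ ≃ ℤ) (he : ∀ k, |k - e k| ≤ 1) :
    ∑' k, tent n k * u (e k) ^ 2 ≤ ∑' k, tent n k * u k ^ 2 + 1 / n * ‖u‖ ^ 2 := by
  have hs := summable_sq_apply u
  have h1 := summable_tent_mul n hs (fun k => sq_nonneg _)
  have hse : Summable fun k => u (e k) ^ 2 := (e.summable_iff (f := fun k => u k ^ 2)).2 hs
  calc ∑' k, tent n k * u (e k) ^ 2
      ≤ ∑' k, (tent n (e k) * u (e k) ^ 2 + 1 / n * u (e k) ^ 2) := by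
        refine Summable.tsum_le_tsum (fun k => ?_)
          (summable_tent_mul n hse (fun k => sq_nonneg _)) ?_
        · rw [← add_mul]
          exact mul_le_mul_of_nonneg_right (tent_le_add (he k)) (sq_nonneg _)
        · exact (e.summable_iff (f := fun k => tent n k * u k ^ 2 + 1 / n * u k ^ 2)).2
            (h1.add (hs.mul_left _))
    _ = ∑' k, (tent n k * u k ^ 2 + 1 / n * u k ^ 2) :=
        e.tsum_eq (fun k => tent n k * u k ^ 2 + 1 / n * u k ^ 2)
    _ = _ := by rw [(h1.tsum_add (hs.mul_left _)), tsum_mul_left, tsum_sq_apply]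

/-- The exponential rate bounding the growth of the phase space norm. -/
noncomputable def growthRate (ω₀ ω₁ : ℝ) : ℝ := 1 + ω₀ ^ 2 + 6 * ω₁ ^ 2

theorem growthRate_pos (ω₀ ω₁ : ℝ) : 0 < growthRate ω₀ ω₁ := by
  unfold growthRate; positivity

/-- The sum on the left is the time derivative of the weighted sum of `q² + p²`. Young's inequality
leaves a neighbour term `ω₁² u_{k±1}²` on each side; moving each back to its own weight turns the
coefficient 4 into 6 and costs `1/n`. -/
theorem abs_sum_tent_deriv_le (ω₀ ω₁ : ℝ) {n : ℕ} (hn : 0 < n) (u v : L2Z) :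
    |∑ k ∈ Finset.Icc (-n : ℤ) n,
        tent n k * (2 * u k * v k + 2 * v k * force ω₀ ω₁ u k)|
      ≤ growthRate ω₀ ω₁ * (∑ k ∈ Finset.Icc (-n : ℤ) n, tent n k * (u k ^ 2 + v k ^ 2))
        + 2 * ω₁ ^ 2 * (1 / n * ‖u‖ ^ 2) := by
  have hpt : ∀ k, |2 * u k * v k + 2 * v k * force ω₀ ω₁ u k| ≤
      (1 + ω₀ ^ 2 + 4 * ω₁ ^ 2) * (u k ^ 2 + v k ^ 2)
        + ω₁ ^ 2 * (u (k + 1) ^ 2 + u (k - 1) ^ 2) := by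
    intro k
    unfold force
    generalize u k = a
    generalize v k = b
    generalize u (k + 1) = c
    generalize u (k - 1) = d
    have e1 := mul_nonneg (sq_nonneg ω₀) (sq_nonneg (a + b))
    have e2 := mul_nonneg (sq_nonneg ω₀) (sq_nonneg (a - b))
    have e3 := mul_nonneg (sq_nonneg ω₁) (sq_nonneg (a + b))
    have e4 := mul_nonneg (sq_nonneg ω₁) (sq_nonneg (a - b))
    have e5 := mul_nonneg (sq_nonneg ω₁) (sq_nonneg (b + c))
    have e6 := mul_nonneg (sq_nonneg ω₁) (sq_nonneg (b - c))
    have e7 := mul_nonneg (sq_nonneg ω₁) (sq_nonneg (b + d))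
    have e8 := mul_nonneg (sq_nonneg ω₁) (sq_nonneg (b - d))
    have e9 := mul_nonneg (sq_nonneg ω₁) (sq_nonneg a)
    rw [abs_le]
    constructor <;> nlinarith [sq_nonneg (a + b), sq_nonneg (a - b)]
  have hu := summable_sq_apply u
  have h1 := tsum_tent_mul_reindex_le n u (Equiv.addRight 1) (fun k => by simp)
  have h2 := tsum_tent_mul_reindex_le n u (Equiv.addRight (-1)) (fun k => by simp)
  rw [tsum_tent_mul_eq_sum hn, tsum_tent_mul_eq_sum hn] at h1 h2
  simp only [Equiv.coe_addRight, ← sub_eq_add_neg] at h1 h2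
  have h3 : ∑ k ∈ Finset.Icc (-n : ℤ) n, tent n k * u k ^ 2
      ≤ ∑ k ∈ Finset.Icc (-n : ℤ) n, tent n k * (u k ^ 2 + v k ^ 2) :=
    Finset.sum_le_sum fun k _ => mul_le_mul_of_nonneg_left
      (le_add_of_nonneg_right (sq_nonneg _)) (tent_nonneg _ _)
  calc _ ≤ ∑ k ∈ Finset.Icc (-n : ℤ) n,
        |tent n k * (2 * u k * v k + 2 * v k * force ω₀ ω₁ u k)| :=
        Finset.abs_sum_le_sum_abs _ _
    _ ≤ ∑ k ∈ Finset.Icc (-n : ℤ) n, ((1 + ω₀ ^ 2 + 4 * ω₁ ^ 2) * (tent n k * (u k ^ 2 + v k ^ 2))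
        + ω₁ ^ 2 * (tent n k * u (k + 1) ^ 2) + ω₁ ^ 2 * (tent n k * u (k - 1) ^ 2)) := by
        refine Finset.sum_le_sum fun k _ => ?_
        rw [abs_mul, abs_of_nonneg (tent_nonneg n k)]
        calc _ ≤ _ := mul_le_mul_of_nonneg_left (hpt k) (tent_nonneg n k)
          _ = _ := by ring
    _ ≤ _ := by
        rw [Finset.sum_add_distrib, Finset.sum_add_distrib, ← Finset.mul_sum, ← Finset.mul_sum,
          ← Finset.mul_sum]
        unfold growthRate
        nlinarith [mul_le_mul_of_nonneg_left h1 (sq_nonneg ω₁),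
          mul_le_mul_of_nonneg_left h2 (sq_nonneg ω₁),
          mul_le_mul_of_nonneg_left h3 (sq_nonneg ω₁)]

/-! ### Gronwall and uniqueness of solutions -/

/-- Two-sided Gronwall estimate with a constant forcing. -/
theorem add_le_exp_mul_add {f f' : ℝ → ℝ} {a b K e : ℝ}
    (hcont : ContinuousOn f (Set.Icc a b))
    (hderiv : ∀ t ∈ Set.Ioo a b, HasDerivAt f (f' t) t)
    (hbound : ∀ t ∈ Set.Ioo a b, |f' t| ≤ K * (f t + e))
    {s t : ℝ} (hs : s ∈ Set.Icc a b) (ht : t ∈ Set.Icc a b) :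
    f t + e ≤ Real.exp (K * |t - s|) * (f s + e) := by
  have hE : ∀ c t : ℝ, HasDerivAt (fun t => Real.exp (c * t)) (Real.exp (c * t) * c) t := by
    intro c t
    simpa using ((hasDerivAt_id t).const_mul c).exp
  have hd : ∀ c, ∀ t ∈ Set.Ioo a b, HasDerivAt (fun t => Real.exp (c * t) * (f t + e))
      (Real.exp (c * t) * (c * (f t + e) + f' t)) t := by
    intro c t ht
    refine ((hE c t).mul ((hderiv t ht).add_const e)).congr_deriv ?_
    ring
  have hc : ∀ c, ContinuousOn (fun t => Real.exp (c * t) * (f t + e)) (Set.Icc a b) := fun c =>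
    (by fun_prop : Continuous fun t => Real.exp (c * t)).continuousOn.mul
      (hcont.add continuousOn_const)
  rcases le_total s t with h | h
  · have hanti : AntitoneOn (fun t => Real.exp (-K * t) * (f t + e)) (Set.Icc a b) := by
      refine antitoneOn_of_deriv_nonpos (convex_Icc a b) (hc _) ?_ ?_
      · rw [interior_Icc]
        exact fun t ht => (hd _ t ht).differentiableAt.differentiableWithinAt
      · rw [interior_Icc]
        intro t ht
        rw [(hd _ t ht).deriv]
        have := (abs_le.1 (hbound t ht)).2
        exact mul_nonpos_of_nonneg_of_nonpos (Real.exp_pos _).le (by linarith)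
    have h1 := hanti hs ht h
    simp only at h1
    rw [abs_of_nonneg (by linarith)]
    calc f t + e = Real.exp (K * t) * (Real.exp (-K * t) * (f t + e)) := by
          rw [← mul_assoc, ← Real.exp_add]; simp
      _ ≤ Real.exp (K * t) * (Real.exp (-K * s) * (f s + e)) := by gcongr
      _ = _ := by rw [← mul_assoc, ← Real.exp_add]; ring_nf
  · have hmono : MonotoneOn (fun t => Real.exp (K * t) * (f t + e)) (Set.Icc a b) := by
      refine monotoneOn_of_deriv_nonneg (convex_Icc a b) (hc _) ?_ ?_
      · rw [interior_Icc]
        exact fun t ht => (hd _ t ht).differentiableAt.differentiableWithinAt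
      · rw [interior_Icc]
        intro t ht
        rw [(hd _ t ht).deriv]
        have := (abs_le.1 (hbound t ht)).1
        exact mul_nonneg (Real.exp_pos _).le (by linarith)
    have h1 := hmono ht hs h
    simp only at h1
    rw [abs_of_nonpos (by linarith)]
    calc f t + e = Real.exp (-K * t) * (Real.exp (K * t) * (f t + e)) := by
          rw [← mul_assoc, ← Real.exp_add]; simp
      _ ≤ Real.exp (-K * t) * (Real.exp (K * s) * (f s + e)) := by gcongr
      _ = _ := by rw [← mul_assoc, ← Real.exp_add]; ring_nf

variable {ω₀ ω₁ : ℝ} {q p q' p' : ℝ → L2Z}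

theorem IsSolution.sub (h : IsSolution ω₀ ω₁ q p) (h' : IsSolution ω₀ ω₁ q' p') :
    IsSolution ω₀ ω₁ (fun t => q t - q' t) (fun t => p t - p' t) where
  deriv_q t ht k := (h.deriv_q t ht k).sub (h'.deriv_q t ht k)
  deriv_p t ht k := by
    refine ((h.deriv_p t ht k).sub (h'.deriv_p t ht k)).congr_deriv ?_
    simp only [force, lp.coeFn_sub, Pi.sub_apply]
    ring

/-- Tent-weighted sums are finite, so coordinatewise derivatives suffice for Gronwall. The bound on
the norms makes the leakage `O(1/n)` uniformly in time, and it disappears as `n → ∞`. -/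
theorem IsSolution.le_exp_mul_of_bddAbove (h : IsSolution ω₀ ω₁ q p) {a b : ℝ} (ha : 0 ≤ a)
    (hb : BddAbove ((fun t => ‖q t‖ ^ 2 + ‖p t‖ ^ 2) '' Set.Icc a b))
    {s t : ℝ} (hs : s ∈ Set.Icc a b) (ht : t ∈ Set.Icc a b) :
    ‖q t‖ ^ 2 + ‖p t‖ ^ 2
      ≤ Real.exp (growthRate ω₀ ω₁ * |t - s|) * (‖q s‖ ^ 2 + ‖p s‖ ^ 2) := by
  obtain ⟨B, hB⟩ := hb
  have hB' : ∀ r ∈ Set.Icc a b, ‖q r‖ ^ 2 ≤ B := fun r hr =>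
    (le_add_of_nonneg_right (sq_nonneg _)).trans (hB ⟨r, hr, rfl⟩)
  have hK := growthRate_pos ω₀ ω₁
  set K := growthRate ω₀ ω₁ with hKdef
  -- Chosen so that `K * (c / n)` equals the leakage bound `2 ω₁² B / n`.
  set c : ℝ := 2 * ω₁ ^ 2 * B / K with hc
  have hlim : ∀ r, Tendsto (fun n : ℕ => ∑' k, tent n k * (q r k ^ 2 + p r k ^ 2) + c * (1 / n))
      atTop (𝓝 (‖q r‖ ^ 2 + ‖p r‖ ^ 2)) := by
    intro r
    have h1 := tendsto_tsum_tent_mul ((summable_sq_apply (q r)).add (summable_sq_apply (p r)))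
      (fun k => add_nonneg (sq_nonneg _) (sq_nonneg _))
    rw [(summable_sq_apply (q r)).tsum_add (summable_sq_apply (p r)), tsum_sq_apply,
      tsum_sq_apply] at h1
    simpa using h1.add (tendsto_one_div_atTop_nhds_zero_nat.const_mul c)
  refine le_of_tendsto_of_tendsto (hlim t) ((hlim s).const_mul _) ?_
  filter_upwards [eventually_gt_atTop 0] with n hn
  rw [tsum_tent_mul_eq_sum hn, tsum_tent_mul_eq_sum hn]
  have hd : ∀ r, 0 ≤ r → HasDerivWithinAt
      (fun r => ∑ k ∈ Finset.Icc (-n : ℤ) n, tent n k * (q r k ^ 2 + p r k ^ 2))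
      (∑ k ∈ Finset.Icc (-n : ℤ) n,
        tent n k * (2 * q r k * p r k + 2 * p r k * force ω₀ ω₁ (q r) k)) (Set.Ici 0) r := by
    intro r hr
    refine HasDerivWithinAt.fun_sum fun k _ => ?_
    refine (((h.deriv_q r hr k).pow 2).add ((h.deriv_p r hr k).pow 2)).const_mul (tent n k)
      |>.congr_deriv ?_
    norm_num
  refine add_le_exp_mul_add (a := a) (b := b) ?_
    (fun r hr => (hd r (ha.trans hr.1.le)).hasDerivAt (Ici_mem_nhds (ha.trans_lt hr.1))) ?_ hs ht
  · intro r hr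
    exact (hd r (ha.trans hr.1)).continuousWithinAt.mono fun x hx => ha.trans hx.1
  · intro r hr
    refine (abs_sum_tent_deriv_le ω₀ ω₁ hn (q r) (p r)).trans ?_
    have hq := hB' r ⟨hr.1.le, hr.2.le⟩
    rw [mul_add, ← hKdef]
    have e1 : K * (c * (1 / n)) = 2 * ω₁ ^ 2 * (1 / n * B) := by
      rw [hc]; field_simp
    rw [e1]
    gcongr

/-- Lower semicontinuity in disguise: sublevel sets become intersections of conditions on finitely
many coordinates, so coordinatewise continuity makes them closed in time. -/
theorem norm_sq_add_norm_sq_le_iff (u v : L2Z) (N : ℝ) :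
    ‖u‖ ^ 2 + ‖v‖ ^ 2 ≤ N ↔ ∀ s : Finset ℤ, ∑ k ∈ s, (u k ^ 2 + v k ^ 2) ≤ N := by
  have h := (hasSum_sq_apply u).add (hasSum_sq_apply v)
  constructor
  · intro hN s
    exact (sum_le_hasSum s (fun k _ => add_nonneg (sq_nonneg _) (sq_nonneg _)) h).trans hN
  · intro hs
    exact hasSum_le_of_sum_le h hs

theorem IsSolution.eq_zero (h : IsSolution ω₀ ω₁ q p) (hq : q 0 = 0) (hp : p 0 = 0)
    {t : ℝ} (ht : 0 ≤ t) : q t = 0 ∧ p t = 0 := by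
  set φ : ℝ → ℝ := fun t => ‖q t‖ ^ 2 + ‖p t‖ ^ 2 with hφ
  have hK := growthRate_pos ω₀ ω₁
  -- The solution is frozen at its initial value for negative times, so that the Baire argument runs
  -- on all of `ℝ`.
  have hcq : ∀ k, Continuous fun t => q (max t 0) k := fun k =>
    ContinuousOn.comp_continuous (s := Set.Ici 0) (g := fun t => q t k) (f := fun t => max t 0)
      (fun r hr => (h.deriv_q r hr k).continuousWithinAt)
      (by fun_prop) (fun r => Set.mem_Ici.2 (le_max_right _ _))
  have hcp : ∀ k, Continuous fun t => p (max t 0) k := fun k =>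
    ContinuousOn.comp_continuous (s := Set.Ici 0) (g := fun t => p t k) (f := fun t => max t 0)
      (fun r hr => (h.deriv_p r hr k).continuousWithinAt)
      (by fun_prop) (fun r => Set.mem_Ici.2 (le_max_right _ _))
  have hclosed : ∀ N : ℕ, IsClosed {t | φ (max t 0) ≤ N} := by
    intro N
    simp only [hφ, norm_sq_add_norm_sq_le_iff, Set.ofPred_forall]
    refine isClosed_iInter fun s => isClosed_le ?_ continuous_const
    exact continuous_finsetSum _ fun k _ => ((hcq k).pow 2).add ((hcp k).pow 2)
  have hg : ∀ a b, BddAbove ((fun t => φ (max t 0)) '' Set.Icc a b) →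
      ∀ x ∈ Set.Icc a b, ∀ y ∈ Set.Icc a b,
      φ (max x 0) ≤ Real.exp (growthRate ω₀ ω₁ * |x - y|) * φ (max y 0) := by
    intro a b hab x hx y hy
    have hmem : ∀ z ∈ Set.Icc a b, max z 0 ∈ Set.Icc (max a 0) (max b 0) := fun z hz =>
      ⟨max_le_max_right _ hz.1, max_le_max_right _ hz.2⟩
    have := h.le_exp_mul_of_bddAbove (a := max a 0) (b := max b 0) (le_max_right _ _) (by
      refine hab.mono ?_
      rintro _ ⟨z, hz, rfl⟩
      by_cases hz0 : z ∈ Set.Icc a b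
      · refine ⟨z, hz0, ?_⟩
        simp only [hφ]
        rw [max_eq_left ((le_max_right _ _).trans hz.1)]
      -- This happens only for `b < 0`: the clipped interval is then the point 0, whose value the
      -- frozen function takes at `b`.
      · have hb0 : b < z ∨ z < a := by
          by_contra hcon
          push Not at hcon
          exact hz0 ⟨hcon.2, hcon.1⟩
        have hza : a ≤ z := (le_max_left _ _).trans hz.1
        have hbz : b < z := by
          rcases hb0 with h | h
          · exact h
          · linarith
        have hz00 : z ≤ 0 := by
          rcases le_max_iff.1 hz.2 with h | h
          · linarith
          · exact h
        refine ⟨b, ⟨hx.1.trans hx.2, le_rfl⟩, ?_⟩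
        have : z = 0 := le_antisymm hz00 ((le_max_right _ _).trans hz.1)
        simp only [hφ]
        rw [max_eq_right (by linarith), this]) (hmem y hy) (hmem x hx)
    refine this.trans ?_
    have habs : |max x 0 - max y 0| ≤ |x - y| := abs_max_sub_max_le_abs x y 0
    have : 0 ≤ φ (max y 0) := add_nonneg (sq_nonneg _) (sq_nonneg _)
    gcongr
  have hloc := eventually_le_of_forall_exp_bound (ψ := fun t => φ (max t 0)) hK.le
    (fun x => add_nonneg (sq_nonneg _) (sq_nonneg _)) hclosed hg
  have hfin := hg 0 t (bddAbove_image_Icc_of_forall_eventually_le fun s _ => hloc s)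
    t ⟨ht, le_rfl⟩ 0 ⟨le_rfl, ht⟩
  rw [max_eq_left ht] at hfin
  simp only [hφ, max_self, hq, hp, norm_zero] at hfin
  have h1 := sq_nonneg ‖q t‖
  have h2 := sq_nonneg ‖p t‖
  norm_num at hfin
  constructor
  · have : ‖q t‖ ^ 2 = 0 := by linarith
    simpa using this
  · have : ‖p t‖ ^ 2 = 0 := by linarith
    simpa using this

theorem IsSolution.eq_flow (h : IsSolution ω₀ ω₁ q p) {t : ℝ} (ht : 0 ≤ t) :
    (q t, p t) = flow ω₀ ω₁ t (q 0, p 0) := by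
  have := (h.sub (isSolution_flow ω₀ ω₁ (q 0, p 0))).eq_zero (by simp) (by simp) ht
  exact Prod.ext (sub_eq_zero.1 this.1) (sub_eq_zero.1 this.2)

/-! ### Spectral representation of the unpinned chain -/

section Spectral

open MeasureTheory Real

/-- Lebesgue measure on the half band `(0, π / 2)` of wave numbers. -/
noncomputable def bandMeasure : Measure ℝ := volume.restrict (Set.Ioo 0 (π / 2))

instance : IsFiniteMeasure bandMeasure := by
  unfold bandMeasure; infer_instance

/-- The cosine coefficient of index `m` of a function on the half band. -/
noncomputable def cosCoeff (g : ℝ → ℝ) (m : ℤ) : ℝ :=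
  ∫ θ, g θ * cos (2 * m * θ) ∂bandMeasure

theorem ae_bandMeasure_iff {p : ℝ → Prop} (h : ∀ θ ∈ Set.Ioo 0 (π / 2), p θ) :
    ∀ᵐ θ ∂bandMeasure, p θ :=
  ae_restrict_of_forall_mem measurableSet_Ioo h

theorem sin_pos_of_mem_band {θ : ℝ} (h : θ ∈ Set.Ioo 0 (π / 2)) : 0 < sin θ :=
  sin_pos_of_pos_of_lt_pi h.1 (by linarith [h.2, pi_pos])

/-- Extend `g` by zero to a circle of length `π`: the cosine coefficient is `π` times the real part
of a Fourier coefficient, and Parseval applies. -/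
theorem summable_sq_cosCoeff {g : ℝ → ℝ} (hg : MemLp g 2 bandMeasure) :
    Summable fun m => cosCoeff g m ^ 2 := by
  set f : ℝ → ℂ := fun θ => (((Set.Ioo 0 (π / 2)).indicator g θ : ℝ) : ℂ) with hf
  have hsub : Set.Ioo 0 (π / 2) ⊆ Set.Ioc 0 π := fun x hx => ⟨hx.1, by linarith [hx.2, pi_pos]⟩
  have hL2 : MemLp f 2 (volume.restrict (Set.Ioc 0 π)) := by
    have h1 : MemLp ((Set.Ioo 0 (π / 2)).indicator g) 2 volume :=
      (memLp_indicator_iff_restrict measurableSet_Ioo).2 hg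
    exact (h1.mono_measure Measure.restrict_le_self).ofReal
  have hs := (hasSum_sq_fourierCoeffOn pi_pos hL2).summable
  refine Summable.of_nonneg_of_le (fun m => sq_nonneg _) (fun m => ?_) (hs.mul_left (π ^ 2))
  have hint : Integrable f (volume.restrict (Set.Ioc 0 π)) := hL2.integrable one_le_two
  have hint2 : Integrable (fun x : ℝ => fourier (-m) (x : AddCircle (π - 0)) • f x)
      (volume.restrict (Set.Ioc 0 π)) := by
    refine hint.bdd_mul (c := 1) ?_ ?_
    · exact ((map_continuous (fourier (-m))).comp
        (AddCircle.continuous_mk' _)).aestronglyMeasurable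
    · exact Eventually.of_forall fun x => by rw [fourier_apply]; exact (Circle.norm_coe _).le
  have hcoef : cosCoeff g m = (∫ x in (0)..π, fourier (-m) (x : AddCircle (π - 0)) • f x).re := by
    rw [intervalIntegral.integral_of_le pi_pos.le]
    have h1 := (Complex.reCLM.integral_comp_comm hint2)
    simp only [Complex.reCLM_apply] at h1
    rw [← h1, cosCoeff, bandMeasure, ← integral_indicator measurableSet_Ioo,
      ← integral_indicator measurableSet_Ioc]
    congr 1
    ext x
    by_cases hx : x ∈ Set.Ioo 0 (π / 2)
    · rw [Set.indicator_of_mem hx, Set.indicator_of_mem (hsub hx), hf]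
      simp only [Set.indicator_of_mem hx, smul_eq_mul, Complex.re_mul_ofReal]
      rw [fourier_coe_apply, mul_comm]
      congr 1
      have : (2 * (π : ℂ) * Complex.I * ((-m : ℤ) : ℂ) * x / ((π - 0 : ℝ) : ℂ))
          = ((-(2 * m * x) : ℝ) : ℂ) * Complex.I := by
        have : (π : ℂ) ≠ 0 := by exact_mod_cast pi_ne_zero
        push_cast
        rw [sub_zero]
        field_simp
      rw [this, Complex.exp_ofReal_mul_I_re, cos_neg]
    · rw [Set.indicator_of_notMem hx]
      by_cases hx' : x ∈ Set.Ioc 0 π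
      · rw [Set.indicator_of_mem hx', hf]
        simp [Set.indicator_of_notMem hx]
      · rw [Set.indicator_of_notMem hx']
  have hnorm : |cosCoeff g m| ≤ π * ‖fourierCoeffOn pi_pos f m‖ := by
    rw [hcoef, fourierCoeffOn_eq_integral, norm_smul]
    refine (Complex.abs_re_le_norm _).trans (le_of_eq ?_)
    rw [sub_zero, Real.norm_of_nonneg (by positivity)]
    field_simp
  calc cosCoeff g m ^ 2 = |cosCoeff g m| ^ 2 := (sq_abs _).symm
    _ ≤ (π * ‖fourierCoeffOn pi_pos f m‖) ^ 2 := by gcongr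
    _ = _ := by rw [mul_pow]

/-- The square summable sequence of cosine coefficients, centred at the particle `j`. -/
noncomputable def cosCoeffSeq (j : ℤ) (g : ℝ → ℝ) (hg : MemLp g 2 bandMeasure) : L2Z :=
  ⟨fun n => cosCoeff g (n - j), memLp_two_of_summable_sq
    ((summable_sq_cosCoeff hg).comp_injective (sub_left_injective (b := j)))⟩

@[simp] theorem cosCoeffSeq_apply (j : ℤ) (g : ℝ → ℝ) (hg : MemLp g 2 bandMeasure) (n : ℤ) :
    cosCoeffSeq j g hg n = cosCoeff g (n - j) := rfl

theorem integrable_mul_of_bounded {P φ : ℝ → ℝ} (hP : Integrable P bandMeasure)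
    (hφ : Continuous φ) {C : ℝ} (hC : ∀ θ, |φ θ| ≤ C) :
    Integrable (fun θ => P θ * φ θ) bandMeasure :=
  hP.mul_bdd hφ.aestronglyMeasurable (Eventually.of_forall hC)

theorem integrable_mul_cos {g : ℝ → ℝ} (hg : Integrable g bandMeasure) (c : ℝ) :
    Integrable (fun θ => g θ * cos (c * θ)) bandMeasure :=
  integrable_mul_of_bounded hg (by fun_prop) (C := 1) fun θ => abs_cos_le_one _

theorem memLp_mul_of_bounded {P φ : ℝ → ℝ} (hP : MemLp P 2 bandMeasure)
    (hφ : Continuous φ) {C : ℝ} (hC : ∀ θ, |φ θ| ≤ C) :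
    MemLp (fun θ => P θ * φ θ) 2 bandMeasure := by
  refine MemLp.of_le_mul (c := C) hP (hP.1.mul hφ.aestronglyMeasurable)
    (Eventually.of_forall fun θ => ?_)
  rw [norm_mul, mul_comm]
  exact mul_le_mul_of_nonneg_right (hC θ) (norm_nonneg _)

/-- Differentiation under the integral needs a time-uniform bound only for `φ'`; the bound on `φ`
may grow, as `|t|` does for `positionSymbol`. -/
theorem hasDerivAt_cosCoeff {P : ℝ → ℝ} {φ φ' : ℝ → ℝ → ℝ} (hP : Integrable P bandMeasure)
    (hφ : ∀ t, Continuous (φ t)) (hφ' : ∀ t, Continuous (φ' t)) {B : ℝ → ℝ} {C : ℝ}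
    (hB : ∀ t θ, |φ t θ| ≤ B t) (hC : ∀ t θ, |φ' t θ| ≤ C)
    (hd : ∀ θ ∈ Set.Ioo 0 (π / 2), ∀ t, HasDerivAt (fun t => φ t θ) (φ' t θ) t) (m : ℤ) (t : ℝ) :
    HasDerivAt (fun t => cosCoeff (fun θ => P θ * φ t θ) m)
      (cosCoeff (fun θ => P θ * φ' t θ) m) t := by
  have hint := fun t => integrable_mul_cos (integrable_mul_of_bounded hP (hφ t) (hB t)) (2 * m)
  have hint' := fun t => integrable_mul_cos (integrable_mul_of_bounded hP (hφ' t) (hC t)) (2 * m)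
  refine (hasDerivAt_integral_of_dominated_loc_of_deriv_le (s := Set.univ)
    (F' := fun t θ => P θ * φ' t θ * cos (2 * m * θ)) (bound := fun θ => |P θ| * C) univ_mem
    (Eventually.of_forall fun t => (hint t).1) (hint t) (hint' t).1 ?_
    (hP.abs.mul_const C) ?_).2
  · refine Eventually.of_forall fun θ s _ => ?_
    rw [norm_mul, norm_mul]
    calc ‖P θ‖ * ‖φ' s θ‖ * ‖cos (2 * m * θ)‖ ≤ ‖P θ‖ * C * 1 := by
          have h0 : 0 ≤ C := (abs_nonneg _).trans (hC s θ)
          have h1 : ‖φ' s θ‖ ≤ C := hC s θ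
          have h2 : ‖cos (2 * m * θ)‖ ≤ 1 := abs_cos_le_one _
          gcongr
      _ = _ := by rw [mul_one]; rfl
  · refine ae_bandMeasure_iff fun θ hθ s _ => ?_
    exact ((hd θ hθ s).const_mul (P θ)).mul_const _

/-- The dispersion relation of the unpinned chain at wave number `2θ`. -/
noncomputable def dispersion (ω₁ θ : ℝ) : ℝ := 2 * ω₁ * sin θ

/-- The position at time `t` of a harmonic oscillator started with unit velocity at the origin. -/
noncomputable def positionSymbol (ω₁ t θ : ℝ) : ℝ := t * sinc (t * dispersion ω₁ θ)

theorem continuous_dispersion (ω₁ : ℝ) : Continuous (dispersion ω₁) := by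
  unfold dispersion; fun_prop

theorem dispersion_pos {ω₁ θ : ℝ} (hω₁ : 0 < ω₁) (hθ : θ ∈ Set.Ioo 0 (π / 2)) :
    0 < dispersion ω₁ θ :=
  mul_pos (by linarith) (sin_pos_of_mem_band hθ)

theorem continuous_positionSymbol (ω₁ t : ℝ) : Continuous (positionSymbol ω₁ t) :=
  continuous_const.mul (continuous_sinc.comp (continuous_const.mul (continuous_dispersion ω₁)))

theorem abs_positionSymbol_le (ω₁ t θ : ℝ) : |positionSymbol ω₁ t θ| ≤ |t| := by
  rw [positionSymbol, abs_mul]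
  exact mul_le_of_le_one_right (abs_nonneg _) (abs_sinc_le_one _)

theorem positionSymbol_eq_div {ω₁ θ : ℝ} (t : ℝ) (h : dispersion ω₁ θ ≠ 0) :
    positionSymbol ω₁ t θ = sin (t * dispersion ω₁ θ) / dispersion ω₁ θ := by
  rcases eq_or_ne t 0 with rfl | ht
  · simp [positionSymbol]
  · rw [positionSymbol, sinc_of_ne_zero (mul_ne_zero ht h)]
    field_simp

/-- The discrete Laplacian is diagonal on cosines; times `ω₁²`, its symbol is minus the square of
`dispersion`. -/
theorem cosCoeff_add_sub (g : ℝ → ℝ) (hg : Integrable g bandMeasure) (m : ℤ) :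
    cosCoeff g (m + 1) + cosCoeff g (m - 1) - 2 * cosCoeff g m
      = cosCoeff (fun θ => g θ * (-4 * sin θ ^ 2)) m := by
  have h1 := integrable_mul_cos hg (2 * (m + 1 : ℤ))
  have h2 := integrable_mul_cos hg (2 * (m - 1 : ℤ))
  have h3 := integrable_mul_cos hg (2 * m)
  unfold cosCoeff
  rw [← integral_const_mul, ← integral_add h1 h2, ← integral_sub (by exact h1.add h2) (h3.const_mul 2)]
  congr 1
  ext θ
  push_cast
  rw [show 2 * ((m : ℝ) + 1) * θ = 2 * m * θ + 2 * θ by ring,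
    show 2 * ((m : ℝ) - 1) * θ = 2 * m * θ - 2 * θ by ring, cos_add, cos_sub, cos_two_mul, cos_sq']
  ring

/-- The chain started at rest position with the spectral velocity profile `P` centred at `j`. -/
theorem isSolution_spectral {ω₁ : ℝ} (hω₁ : 0 < ω₁) (j : ℤ) {P : ℝ → ℝ}
    (hP : MemLp P 2 bandMeasure) :
    IsSolution 0 ω₁
      (fun t => cosCoeffSeq j (fun θ => P θ * positionSymbol ω₁ t θ)
        (memLp_mul_of_bounded hP (continuous_positionSymbol ω₁ t) (abs_positionSymbol_le ω₁ t)))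
      (fun t => cosCoeffSeq j (fun θ => P θ * cos (t * dispersion ω₁ θ))
        (memLp_mul_of_bounded hP
          (continuous_cos.comp (continuous_const.mul (continuous_dispersion ω₁)))
          (fun _ => abs_cos_le_one _))) := by
  have hPi : Integrable P bandMeasure := hP.integrable one_le_two
  have hcos : ∀ t, Continuous fun θ => cos (t * dispersion ω₁ θ) := fun t =>
    continuous_cos.comp (continuous_const.mul (continuous_dispersion ω₁))
  have hlin : ∀ a t : ℝ, HasDerivAt (fun t => t * a) a t := fun a t => by
    simpa using (hasDerivAt_id t).mul_const a
  constructor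
  · intro t _ k
    simp only [cosCoeffSeq_apply]
    refine (hasDerivAt_cosCoeff hPi (continuous_positionSymbol ω₁) hcos
      (abs_positionSymbol_le ω₁) (C := 1) (fun _ _ => abs_cos_le_one _) ?_ (k - j) t).hasDerivWithinAt
    intro θ hθ t
    have h0 := (dispersion_pos hω₁ hθ).ne'
    simp only [fun t => positionSymbol_eq_div t h0]
    refine ((hlin _ t).sin.div_const _).congr_deriv ?_
    field_simp
  · intro t _ k
    simp only [cosCoeffSeq_apply]
    have h := hasDerivAt_cosCoeff hPi hcos
      (φ' := fun t θ => -sin (t * dispersion ω₁ θ) * dispersion ω₁ θ)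
      (fun t => ((continuous_sin.comp (continuous_const.mul (continuous_dispersion ω₁))).neg).mul
        (continuous_dispersion ω₁)) (B := fun _ => 1) (C := 2 * ω₁)
      (fun _ _ => abs_cos_le_one _) (fun t θ => by
        rw [abs_mul, abs_neg, dispersion, abs_mul, abs_of_pos (by linarith : 0 < 2 * ω₁)]
        have h1 := abs_sin_le_one (t * (2 * ω₁ * sin θ))
        have h2 := abs_sin_le_one θ
        calc _ ≤ 1 * (2 * ω₁ * 1) := by gcongr
          _ = _ := by ring)
      (fun θ _ t => (hlin _ t).cos) (k - j) t
    refine h.hasDerivWithinAt.congr_deriv ?_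
    have hpos : Integrable (fun θ => P θ * positionSymbol ω₁ t θ) bandMeasure :=
      integrable_mul_of_bounded hPi (continuous_positionSymbol ω₁ t) (abs_positionSymbol_le ω₁ t)
    have h2 := cosCoeff_add_sub _ hpos (k - j)
    simp only [force, cosCoeffSeq_apply]
    rw [show k + 1 - j = k - j + 1 by ring, show k - 1 - j = k - j - 1 by ring]
    calc _ = ω₁ ^ 2 * cosCoeff (fun θ => P θ * positionSymbol ω₁ t θ * (-4 * sin θ ^ 2)) (k - j) := by
          unfold cosCoeff
          rw [← integral_const_mul]
          refine integral_congr_ae (ae_bandMeasure_iff fun θ hθ => ?_)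
          have h0 := (dispersion_pos hω₁ hθ).ne'
          simp only []
          rw [positionSymbol_eq_div t h0]
          have h1 : sin (t * dispersion ω₁ θ) / dispersion ω₁ θ * (dispersion ω₁ θ) ^ 2
            = sin (t * dispersion ω₁ θ) * dispersion ω₁ θ := by field_simp
          have h3 : dispersion ω₁ θ ^ 2 = 4 * ω₁ ^ 2 * sin θ ^ 2 := by unfold dispersion; ring
          rw [h3] at h1
          linear_combination (P θ * cos (2 * ↑(k - j) * θ)) * h1
      _ = _ := by rw [← h2]; ring

theorem cosCoeffSeq_congr {j : ℤ} {f g : ℝ → ℝ} {hf : MemLp f 2 bandMeasure}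
    {hg : MemLp g 2 bandMeasure} (h : f = g) : cosCoeffSeq j f hf = cosCoeffSeq j g hg := by
  subst h; rfl

/-- Uniqueness identifies the abstract group with the explicit spectral solution. -/
theorem flow_cosCoeffSeq_fst {ω₁ : ℝ} (hω₁ : 0 < ω₁) (j : ℤ) {P : ℝ → ℝ}
    (hP : MemLp P 2 bandMeasure) {t : ℝ} (ht : 0 ≤ t) (n : ℤ) :
    (flow 0 ω₁ t (0, cosCoeffSeq j P hP)).1 n
      = cosCoeff (fun θ => P θ * positionSymbol ω₁ t θ) (n - j) := by
  have h := (isSolution_spectral hω₁ j hP).eq_flow ht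
  have h0 : cosCoeffSeq j (fun θ => P θ * positionSymbol ω₁ 0 θ)
      (memLp_mul_of_bounded hP (continuous_positionSymbol ω₁ 0) (abs_positionSymbol_le ω₁ 0))
      = 0 := by
    ext n
    simp [cosCoeff, positionSymbol]
  have h1 : ∀ h, cosCoeffSeq j (fun θ => P θ * cos (0 * dispersion ω₁ θ)) h
      = cosCoeffSeq j P hP := fun h => cosCoeffSeq_congr (by ext; simp)
  rw [h0, h1] at h
  rw [← h]
  rfl

theorem integral_bandMeasure (f : ℝ → ℝ) : ∫ θ, f θ ∂bandMeasure = ∫ θ in (0)..(π / 2), f θ := by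
  rw [intervalIntegral.integral_of_le (by positivity), integral_Ioc_eq_integral_Ioo]
  rfl

theorem cosCoeff_const (c : ℝ) (m : ℤ) :
    cosCoeff (fun _ => c) m = if m = 0 then c * (π / 2) else 0 := by
  rw [cosCoeff, integral_bandMeasure]
  split_ifs with h
  · subst h
    simp [mul_comm]
  · have hm : (2 * (m : ℝ)) ≠ 0 := by simpa using h
    rw [intervalIntegral.integral_const_mul, intervalIntegral.integral_comp_mul_left _ hm,
      integral_cos]
    rw [show 2 * (m : ℝ) * (π / 2) = m * π by ring, sin_int_mul_pi]
    simp

theorem memLp_const_band (c : ℝ) : MemLp (fun _ => c) 2 bandMeasure := memLp_const c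

theorem cosCoeffSeq_const (j : ℤ) :
    cosCoeffSeq j (fun _ => 2 / π) (memLp_const_band _) = lp.single 2 j (1 : ℝ) := by
  ext n
  rw [cosCoeffSeq_apply, cosCoeff_const, lp.single_apply]
  by_cases h : n = j
  · subst h
    simp
  · rw [if_neg (sub_ne_zero.2 h), Pi.single_eq_of_ne h]

/-! ### Impulse response and logarithmic bounds -/

/-- The deviation of the particle `m` at time `t` when the particle `0` starts with unit
velocity and everything else is at rest. -/
noncomputable def impulseResponse (ω₁ t : ℝ) (m : ℤ) : ℝ :=
  cosCoeff (fun θ => 2 / π * positionSymbol ω₁ t θ) m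

theorem hasSum_impulseResponse {ω₁ : ℝ} (hω₁ : 0 < ω₁) {t : ℝ} (ht : 0 ≤ t) (y : L2Z) (n : ℤ) :
    HasSum (fun k => y k * impulseResponse ω₁ t (n - k)) ((flow 0 ω₁ t (0, y)).1 n) := by
  have h1 := lp.hasSum_single (p := 2) (by norm_num) y
  set L : L2Z →L[ℝ] ℝ := (lp.evalCLM ℝ (fun _ : ℤ => ℝ) 2 n).comp
    ((ContinuousLinearMap.fst ℝ L2Z L2Z).comp
      ((flow 0 ω₁ t).comp (ContinuousLinearMap.inr ℝ L2Z L2Z))) with hL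
  have h2 := h1.mapL L
  refine h2.congr_fun ?_
  intro k
  have h3 : lp.single 2 k (y k) = y k • lp.single (E := fun _ : ℤ => ℝ) 2 k (1 : ℝ) := by
    rw [← lp.single_smul, smul_eq_mul, mul_one]
  have h4 := flow_cosCoeffSeq_fst hω₁ k (memLp_const_band (2 / π)) ht n
  rw [cosCoeffSeq_const] at h4
  rw [h3, map_smul, smul_eq_mul, impulseResponse, ← h4]
  rfl

theorem one_div_sin_le {θ : ℝ} (hθ : θ ∈ Set.Ioo 0 (π / 2)) : 1 / sin θ ≤ 1 / θ + 2 := by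
  have hs := sin_pos_of_mem_band hθ
  have h0 := hθ.1
  rw [div_le_iff₀ hs]
  rcases le_total θ 1 with h | h
  · have h1 := (sin_gt_sub_cube h0).le
    calc (1 : ℝ) ≤ (1 / θ + 2) * (θ - θ ^ 3 / 6) := by
          have : (1 / θ + 2) * (θ - θ ^ 3 / 6) = 1 + θ * (2 - θ / 6 - θ ^ 2 / 3) := by
            field_simp; ring
          rw [this]
          nlinarith [mul_nonneg h0.le (by nlinarith : 0 ≤ 2 - θ / 6 - θ ^ 2 / 3)]
      _ ≤ _ := by gcongr
  · have h1 := mul_le_sin h0.le hθ.2.le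
    have h2 : 1 / 2 ≤ sin θ := by
      refine le_trans ?_ h1
      rw [div_mul_eq_mul_div, div_le_div_iff₀ two_pos pi_pos]
      linarith [pi_le_four]
    have : 0 ≤ 1 / θ := by positivity
    nlinarith

/-- Logarithmic bound for integrals over the band of a function with a mollified pole at `0`. -/
theorem abs_integral_band_le {g : ℝ → ℝ} {x c : ℝ} (hx : 1 ≤ x)
    (h1 : ∀ θ ∈ Set.Ioo 0 (π / 2), |g θ| ≤ c * x)
    (h2 : ∀ θ ∈ Set.Ioo 0 (π / 2), |g θ| ≤ 1 / sin θ) :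
    |∫ θ, g θ ∂bandMeasure| ≤ log x + (c + 6) := by
  have hx0 : 0 < x := by linarith
  have hπ : 1 < π / 2 := by linarith [pi_gt_three]
  have hxi : 1 / x ≤ 1 := by rw [div_le_one hx0]; exact hx
  have hxi0 : 0 < 1 / x := by positivity
  -- The two bounds are split at `1 / x`: the left piece contributes `c`, the right one `log x` plus
  -- at most 5.
  set B : ℝ → ℝ := fun θ => if θ ≤ 1 / x then c * x else 1 / θ + 2 with hB
  have hI1 : IntervalIntegrable B volume 0 (1 / x) := by
    refine (intervalIntegrable_const (c := c * x)).congr fun θ hθ => ?_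
    rw [Set.uIoc_of_le hxi0.le] at hθ
    simp only [hB, if_pos hθ.2]
  have hcont : ContinuousOn (fun θ : ℝ => 1 / θ + 2) (Set.uIcc (1 / x) (π / 2)) := by
    refine ContinuousOn.add (continuousOn_const.div continuousOn_id fun y hy => ?_) continuousOn_const
    rw [Set.uIcc_of_le (by linarith)] at hy
    exact (hxi0.trans_le hy.1).ne'
  have heq2 : ∀ θ ∈ Set.uIoc (1 / x) (π / 2), 1 / θ + 2 = B θ := by
    intro θ hθ
    rw [Set.uIoc_of_le (by linarith)] at hθ
    simp only [hB, if_neg (not_le.2 hθ.1)]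
  have hI2 : IntervalIntegrable B volume (1 / x) (π / 2) :=
    hcont.intervalIntegrable.congr heq2
  have hval : ∫ θ in (0)..(π / 2), B θ ≤ log x + (c + 6) := by
    rw [← intervalIntegral.integral_add_adjacent_intervals hI1 hI2]
    have e1 : ∫ θ in (0)..(1 / x), B θ = c := by
      rw [intervalIntegral.integral_congr_ae (g := fun _ => c * x)]
      · rw [intervalIntegral.integral_const, smul_eq_mul]; field_simp; ring
      · refine Eventually.of_forall fun θ hθ => ?_
        rw [Set.uIoc_of_le hxi0.le] at hθ
        simp only [hB, if_pos hθ.2]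
    have e2 : ∫ θ in (1 / x)..(π / 2), B θ = log (π / 2) + log x + 2 * (π / 2 - 1 / x) := by
      rw [intervalIntegral.integral_congr_ae (g := fun θ => 1 / θ + 2)]
      · rw [intervalIntegral.integral_add _ intervalIntegrable_const, integral_one_div,
          intervalIntegral.integral_const, smul_eq_mul]
        · rw [div_div_eq_mul_div, div_one, log_mul (by positivity) hx0.ne']
          ring
        · rw [Set.uIcc_of_le (by linarith)]
          exact fun h => absurd h.1 (not_le.2 hxi0)
        · refine (continuousOn_const.div continuousOn_id fun y hy => ?_).intervalIntegrable
          rw [Set.uIcc_of_le (by linarith)] at hy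
          exact (hxi0.trans_le hy.1).ne'
      · exact Eventually.of_forall fun θ hθ => (heq2 θ hθ).symm
    rw [e1, e2]
    have : log (π / 2) ≤ π / 2 - 1 := log_le_sub_one_of_pos (by positivity)
    linarith [pi_le_four]
  refine le_trans ?_ hval
  rw [← integral_bandMeasure]
  refine norm_integral_le_of_norm_le (f := g) ?_ (ae_bandMeasure_iff fun θ hθ => ?_)
  · have h := (hI1.trans hI2).1
    rw [bandMeasure]
    exact h.mono_set Set.Ioo_subset_Ioc_self
  · rw [Real.norm_eq_abs]
    simp only [hB]
    split_ifs
    · exact h1 θ hθ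
    · exact (h2 θ hθ).trans (one_div_sin_le hθ)

theorem impulseResponse_eq {ω₁ : ℝ} (hω₁ : 0 < ω₁) (t : ℝ) (m : ℤ) :
    impulseResponse ω₁ t m = 1 / (ω₁ * π) *
      ∫ θ, sin (t * dispersion ω₁ θ) / sin θ * cos (2 * m * θ) ∂bandMeasure := by
  rw [impulseResponse, cosCoeff, ← integral_const_mul]
  refine integral_congr_ae (ae_bandMeasure_iff fun θ hθ => ?_)
  have h0 := (sin_pos_of_mem_band hθ).ne'
  simp only []
  rw [positionSymbol_eq_div t (dispersion_pos hω₁ hθ).ne']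
  rw [show dispersion ω₁ θ = 2 * ω₁ * sin θ from rfl]
  field_simp

theorem abs_impulseResponse_le {ω₁ : ℝ} (hω₁ : 0 < ω₁) {t : ℝ} (ht : 1 ≤ t) (m : ℤ) :
    |impulseResponse ω₁ t m| ≤ 1 / (ω₁ * π) * (log t + (2 * ω₁ + 6)) := by
  rw [impulseResponse_eq hω₁, abs_mul, abs_of_pos (by positivity : 0 < 1 / (ω₁ * π))]
  gcongr
  refine abs_integral_band_le ht (fun θ hθ => ?_) (fun θ hθ => ?_)
  · have hs := sin_pos_of_mem_band hθ
    rw [abs_mul, abs_div, abs_of_pos hs]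
    have h1 : |sin (t * dispersion ω₁ θ)| ≤ t * (2 * ω₁ * sin θ) := by
      refine (abs_sin_le_abs).trans (le_of_eq ?_)
      exact abs_of_nonneg (mul_nonneg (by linarith) (dispersion_pos hω₁ hθ).le)
    calc _ ≤ t * (2 * ω₁ * sin θ) / sin θ * 1 := by
          gcongr
          exact abs_cos_le_one _
      _ = _ := by field_simp
  · have hs := sin_pos_of_mem_band hθ
    rw [abs_mul, abs_div, abs_of_pos hs]
    calc _ ≤ 1 / sin θ * 1 := by
          gcongr
          · exact abs_sin_le_one _
          · exact abs_cos_le_one _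
      _ = _ := mul_one _

theorem integrable_sin_div_sin_mul_cos {ω₁ : ℝ} (hω₁ : 0 < ω₁) (t : ℝ) (c : ℝ) :
    Integrable (fun θ => sin (t * dispersion ω₁ θ) / sin θ * cos (c * θ)) bandMeasure := by
  refine integrable_mul_cos ?_ c
  refine Integrable.congr (f := fun θ => 2 * ω₁ * positionSymbol ω₁ t θ) ?_
    (ae_bandMeasure_iff fun θ hθ => ?_)
  · exact integrable_mul_of_bounded (integrable_const _) (continuous_positionSymbol ω₁ t)
      (abs_positionSymbol_le ω₁ t)
  · simp only []
    rw [positionSymbol_eq_div t (dispersion_pos hω₁ hθ).ne']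
    rw [show dispersion ω₁ θ = 2 * ω₁ * sin θ from rfl]
    have h0 := (sin_pos_of_mem_band hθ).ne'
    field_simp

/-- The difference of cosines produces a factor `sin (k θ)`, which smooths the pole at scale `1 /
|k|` whatever `t` and `n` are. For `k = 0` the convention `log 0 = 0` keeps the right side
nonnegative. -/
theorem abs_impulseResponse_sub_le {ω₁ : ℝ} (hω₁ : 0 < ω₁) (t : ℝ) (n k : ℤ) :
    |impulseResponse ω₁ t (n - k) - impulseResponse ω₁ t n|
      ≤ 2 / (ω₁ * π) * (log |(k : ℝ)| + (2 + 6)) := by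
  rcases eq_or_ne k 0 with rfl | hk
  · simp; positivity
  have hk1 : (1 : ℝ) ≤ |(k : ℝ)| := by exact_mod_cast Int.one_le_abs hk
  rw [impulseResponse_eq hω₁, impulseResponse_eq hω₁, ← mul_sub,
    ← integral_sub (integrable_sin_div_sin_mul_cos hω₁ t _)
      (integrable_sin_div_sin_mul_cos hω₁ t _)]
  have hI : ∀ θ, sin (t * dispersion ω₁ θ) / sin θ * cos (2 * (n - k : ℤ) * θ)
      - sin (t * dispersion ω₁ θ) / sin θ * cos (2 * n * θ)
      = 2 * (sin (t * dispersion ω₁ θ) * sin ((2 * n - k) * θ) * (sin (k * θ) / sin θ)) := by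
    intro θ
    rw [← mul_sub, cos_sub_cos]
    push_cast
    rw [show (2 * ((n : ℝ) - k) * θ + 2 * n * θ) / 2 = (2 * n - k) * θ by ring,
      show (2 * ((n : ℝ) - k) * θ - 2 * n * θ) / 2 = -(k * θ) by ring, sin_neg]
    ring
  simp only [hI]
  rw [integral_const_mul, ← mul_assoc, abs_mul, show 1 / (ω₁ * π) * 2 = 2 / (ω₁ * π) by ring,
    abs_of_pos (by positivity : 0 < 2 / (ω₁ * π))]
  gcongr
  have hle : ∀ θ, |sin (t * dispersion ω₁ θ) * sin ((2 * n - k) * θ)| ≤ 1 := fun θ => by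
    rw [abs_mul]
    exact mul_le_one₀ (abs_sin_le_one _) (abs_nonneg _) (abs_sin_le_one _)
  refine abs_integral_band_le hk1 (fun θ hθ => ?_) (fun θ hθ => ?_)
  · have hs := sin_pos_of_mem_band hθ
    rw [abs_mul, abs_div, abs_of_pos hs]
    have h1 : |sin (k * θ)| ≤ |(k : ℝ)| * θ := by
      refine (abs_sin_le_abs).trans (le_of_eq ?_)
      rw [abs_mul, abs_of_pos hθ.1]
    have h2 : θ ≤ 2 * sin θ := by
      have := mul_le_sin hθ.1.le hθ.2.le
      rw [div_mul_eq_mul_div, div_le_iff₀ pi_pos] at this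
      nlinarith [pi_le_four]
    calc _ ≤ 1 * (|(k : ℝ)| * (2 * sin θ) / sin θ) := by
          gcongr
          · exact hle θ
          · exact h1.trans (by gcongr)
      _ = _ := by field_simp
  · have hs := sin_pos_of_mem_band hθ
    rw [abs_mul, abs_div, abs_of_pos hs]
    calc _ ≤ 1 * (1 / sin θ) := by
          gcongr
          · exact hle θ
          · exact abs_sin_le_one _
      _ = _ := one_mul _

theorem summable_abs_mul_log {u : ℤ → ℝ}
    (h : Summable (fun k : {k : ℤ // k ≠ 0} => |u k| * log |((k : ℤ) : ℝ)|)) :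
    Summable fun k : ℤ => |u k| * log |(k : ℝ)| := by
  rw [← Function.Injective.summable_iff (Subtype.val_injective (p := fun k : ℤ => k ≠ 0))]
  · exact h
  · intro k hk
    have : k = 0 := by simpa using hk
    simp [this]

/-- Since `e < 3`, the logarithmic weight is at least 1 once `|k| ≥ 3`. -/
theorem summable_abs_of_summable_abs_mul_log {u : ℤ → ℝ}
    (h : Summable fun k : ℤ => |u k| * log |(k : ℝ)|) : Summable fun k => |u k| := by
  refine Summable.of_norm_bounded_eventually h ?_
  filter_upwards [(Set.finite_Icc (-2 : ℤ) 2).compl_mem_cofinite] with k hk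
  have hk3 : 3 ≤ |k| := by
    by_contra hcon
    have : |k| ≤ 2 := by omega
    exact hk (Set.mem_Icc.2 (abs_le.1 this))
  have hk3' : (3 : ℝ) ≤ |(k : ℝ)| := by exact_mod_cast hk3
  rw [norm_eq_abs, abs_abs]
  refine le_mul_of_one_le_right (abs_nonneg _) ?_
  rw [le_log_iff_exp_le (by linarith)]
  linarith [exp_one_lt_d9]

/-- Each response at `n - k` is replaced by the one at `n`: the main term carries the total momentum
and `log t`, while the error is summable and independent of `t`. -/
theorem abs_flow_fst_apply_le {ω₁ : ℝ} (hω₁ : 0 < ω₁) (y : L2Z)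
    (h : Summable fun k : ℤ => |y k| * log |(k : ℝ)|) {t : ℝ} (ht : 1 ≤ t) (n : ℤ) :
    |(flow 0 ω₁ t (0, y)).1 n| ≤ 1 / (ω₁ * π) * (|∑' k, y k| * (log t + (2 * ω₁ + 6))
      + 2 * ∑' k : ℤ, (|y k| * log |(k : ℝ)| + |y k| * 8)) := by
  have hy := summable_abs_of_summable_abs_mul_log h
  have h1 := hasSum_impulseResponse hω₁ (by linarith : 0 ≤ t) y n
  have h2 := hy.of_abs.hasSum.mul_right (impulseResponse ω₁ t n)
  have h3 := h1.sub h2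
  have h4 := (h.add (hy.mul_right 8)).mul_left (2 / (ω₁ * π))
  have hb : |(flow 0 ω₁ t (0, y)).1 n - (∑' k, y k) * impulseResponse ω₁ t n|
      ≤ 2 / (ω₁ * π) * ∑' k : ℤ, (|y k| * log |(k : ℝ)| + |y k| * 8) := by
    rw [← tsum_mul_left]
    refine h3.norm_le_of_bounded h4.hasSum fun k => ?_
    rw [← mul_sub, norm_mul, norm_eq_abs, norm_eq_abs]
    calc _ ≤ |y k| * (2 / (ω₁ * π) * (log |(k : ℝ)| + (2 + 6))) :=
          mul_le_mul_of_nonneg_left (abs_impulseResponse_sub_le hω₁ t n k) (abs_nonneg _)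
      _ = _ := by ring
  have hc : |(∑' k, y k) * impulseResponse ω₁ t n|
      ≤ |∑' k, y k| * (1 / (ω₁ * π) * (log t + (2 * ω₁ + 6))) := by
    rw [abs_mul]
    exact mul_le_mul_of_nonneg_left (abs_impulseResponse_le hω₁ ht n) (abs_nonneg _)
  have hsplit := abs_add_le ((flow 0 ω₁ t (0, y)).1 n - (∑' k, y k) * impulseResponse ω₁ t n)
    ((∑' k, y k) * impulseResponse ω₁ t n)
  rw [sub_add_cancel] at hsplit
  refine (hsplit.trans (add_le_add hb hc)).trans (le_of_eq ?_)
  ring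

/-! ### Uniform, square root and logarithmic bounds for solutions -/

variable {ω₀ ω₁ : ℝ} {q p : ℝ → L2Z}

theorem IsSolution.abs_apply_le_abs_flow_add (h : IsSolution 0 ω₁ q p) {t : ℝ} (ht : 0 ≤ t) (n : ℤ) :
    |q t n| ≤ |(flow 0 ω₁ t (0, p 0)).1 n| + ‖q 0‖ := by
  have h1 : q t = (flow 0 ω₁ t (0, p 0)).1 + (flow 0 ω₁ t (0, q 0)).2 := by
    rw [← flow_fst_eq_flow_snd, ← Prod.fst_add, ← map_add, Prod.mk_add_mk, zero_add, add_zero,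
      ← h.eq_flow ht]
  rw [h1, lp.coeFn_add, Pi.add_apply]
  exact (abs_add_le _ _).trans (add_le_add le_rfl
    ((abs_apply_le_norm _ n).trans (norm_flow_snd_le ω₁ t (q 0))))

theorem maxNorm_le_ofReal {u : ℤ → ℝ} {c : ℝ} (h : ∀ k, |u k| ≤ c) :
    maxNorm u ≤ ENNReal.ofReal c :=
  iSup_le fun k => ENNReal.ofReal_le_ofReal (h k)

theorem IsSolution.iSup_maxNorm_lt_top (hω₀ : 0 < ω₀) (h : IsSolution ω₀ ω₁ q p) :
    (⨆ t : ℝ, ⨆ _ : 0 ≤ t, maxNorm (q t)) < ⊤ := by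
  refine lt_of_le_of_lt (iSup₂_le fun t ht => maxNorm_le_ofReal
    (c := √(energy ω₀ ω₁ (q 0, p 0)) / ω₀) fun k => ?_) ENNReal.ofReal_lt_top
  have h1 := energy_flow ω₀ ω₁ t (q 0, p 0)
  rw [← h.eq_flow ht] at h1
  refine (abs_apply_le_norm (q t) k).trans ?_
  rw [le_div_iff₀ hω₀, ← h1]
  refine le_sqrt_of_sq_le ?_
  unfold energy
  nlinarith [sq_nonneg ‖p t‖, sq_nonneg (ω₁ * ‖shift (q t) - q t‖)]

theorem IsSolution.maxNorm_le_sqrt (hω₁ : 0 < ω₁) (h : IsSolution 0 ω₁ q p) {t : ℝ}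
    (ht : 0 ≤ t) :
    maxNorm (q t) ≤ ENNReal.ofReal (2 / √ω₁ * ‖p 0‖ * √t + ‖q 0‖) := by
  refine maxNorm_le_ofReal fun k => (h.abs_apply_le_abs_flow_add ht k).trans (add_le_add ?_ le_rfl)
  refine abs_le_of_sq_le_sq ?_ (by positivity)
  have h1 := sq_apply_le (flow 0 ω₁ t (0, p 0)).1 k
  have h2 := norm_flow_fst_le ω₁ ht (p 0)
  have h3 := norm_shift_sub_flow_fst_le ω₁ t (p 0)
  rw [mul_comm, ← le_div_iff₀ hω₁] at h3
  calc _ ≤ _ := h1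
    _ ≤ 2 * (‖p 0‖ * t) * (‖p 0‖ / ω₁) := by gcongr
    -- Interpolation already gives the constant `√2`; the claimed 2 is weaker.
    _ ≤ 4 * (‖p 0‖ * t) * (‖p 0‖ / ω₁) := by gcongr; norm_num
    _ = _ := by
      rw [mul_pow, mul_pow, div_pow, sq_sqrt hω₁.le, sq_sqrt ht]
      ring

theorem IsSolution.maxNorm_le_log (hω₁ : 0 < ω₁) (h : IsSolution 0 ω₁ q p)
    (hs : Summable fun k : ℤ => |p 0 k| * log |(k : ℝ)|) :
    ∃ c : ℝ, 0 < c ∧ ∀ t : ℝ, 1 ≤ t → maxNorm (q t) ≤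
      ENNReal.ofReal (√2 / (ω₁ * π) * |∑' k : ℤ, p 0 k| * log t + ‖q 0‖ + c) := by
  set c₀ : ℝ := 1 / (ω₁ * π) * (|∑' k, p 0 k| * (2 * ω₁ + 6)
      + 2 * ∑' k : ℤ, (|p 0 k| * log |(k : ℝ)| + |p 0 k| * 8)) with hc₀
  refine ⟨max c₀ 1, lt_max_of_lt_right one_pos, fun t ht => maxNorm_le_ofReal fun k => ?_⟩
  have h1 := abs_flow_fst_apply_le hω₁ (p 0) hs ht k
  have h2 := h.abs_apply_le_abs_flow_add (by linarith : 0 ≤ t) k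
  -- The factor `√2` is slack: the estimate holds with `1 / (ω₁ π)`.
  have h3 : 1 / (ω₁ * π) * |∑' k, p 0 k| * log t ≤ √2 / (ω₁ * π) * |∑' k, p 0 k| * log t := by
    have := log_nonneg ht
    gcongr
    exact one_le_sqrt.2 one_le_two
  have h4 := le_max_left c₀ 1
  have h5 : 1 / (ω₁ * π) * (|∑' k, p 0 k| * (log t + (2 * ω₁ + 6))
      + 2 * ∑' k : ℤ, (|p 0 k| * log |(k : ℝ)| + |p 0 k| * 8))
      = 1 / (ω₁ * π) * |∑' k, p 0 k| * log t + c₀ := by rw [hc₀]; ring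
  linarith

/-! ### A positive moment of the cardinal sine -/

theorem integrableOn_Ioi_of_rpow_bounds {f : ℝ → ℝ} (hf : Measurable f) {C : ℝ}
    (h1 : ∀ u, 0 < u → u ≤ 1 → |f u| ≤ C * u ^ (-(1 / 2) : ℝ))
    (h2 : ∀ u, 1 < u → |f u| ≤ C * u ^ (-(5 / 4) : ℝ)) :
    IntegrableOn f (Set.Ioi 0) := by
  rw [← Set.Ioc_union_Ioi_eq_Ioi (zero_le_one' ℝ)]
  refine IntegrableOn.union ?_ ?_
  · have hi : IntegrableOn (fun u : ℝ => C * u ^ (-(1 / 2) : ℝ)) (Set.Ioc 0 1) :=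
      ((intervalIntegral.intervalIntegrable_rpow' (by norm_num) (a := 0) (b := 1)).const_mul C).1
    exact hi.mono' hf.aestronglyMeasurable
      (ae_restrict_of_forall_mem measurableSet_Ioc fun u hu => h1 u hu.1 hu.2)
  · have hi : IntegrableOn (fun u : ℝ => C * u ^ (-(5 / 4) : ℝ)) (Set.Ioi 1) :=
      (integrableOn_Ioi_rpow_of_lt (by norm_num) one_pos).const_mul C
    exact hi.mono' hf.aestronglyMeasurable
      (ae_restrict_of_forall_mem measurableSet_Ioi fun u hu => h2 u hu)

/-- The dominating function for (c): the exponent `-3/4` is the decay `-1` of the sinc factor plus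
the `1/4` allowed to the logarithmic ratio. -/
theorem integrableOn_rpow_mul_one_add_rpow (C : ℝ) :
    IntegrableOn (fun u : ℝ => C * (u ^ (-(1 / 2) : ℝ) * (1 + u) ^ (-(3 / 4) : ℝ))) (Set.Ioi 0) := by
  refine Integrable.const_mul (integrableOn_Ioi_of_rpow_bounds (C := 1) (by fun_prop)
    (fun u hu _ => ?_) (fun u hu => ?_)) C
  · rw [abs_of_nonneg (by positivity), one_mul]
    exact mul_le_of_le_one_right (by positivity)
      (rpow_le_one_of_one_le_of_nonpos (by linarith) (by norm_num))
  · have hu0 : 0 < u := by linarith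
    rw [abs_of_nonneg (by positivity), one_mul,
      show (-(5 / 4) : ℝ) = -(1 / 2) + -(3 / 4) by norm_num, rpow_add hu0]
    exact mul_le_mul_of_nonneg_left
      (rpow_le_rpow_of_nonpos hu0 (by linarith) (by norm_num)) (by positivity)

theorem one_sub_cos_le_sq_div_two (u : ℝ) : 1 - cos u ≤ u ^ 2 / 2 := by
  linarith [one_sub_sq_div_two_le_cos (x := u)]

theorem integrableOn_rpow_mul_one_sub_cos :
    IntegrableOn (fun u : ℝ => u ^ (-(5 / 2) : ℝ) * (1 - cos u)) (Set.Ioi 0) := by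
  refine integrableOn_Ioi_of_rpow_bounds (C := 2) (by fun_prop) (fun u hu hu1 => ?_) (fun u hu => ?_)
  · have hc : 0 ≤ 1 - cos u := by linarith [cos_le_one u]
    rw [abs_of_nonneg (by positivity)]
    calc u ^ (-(5 / 2) : ℝ) * (1 - cos u) ≤ u ^ (-(5 / 2) : ℝ) * (2 * u ^ (2 : ℝ)) := by
          rw [rpow_two]
          gcongr
          nlinarith [one_sub_cos_le_sq_div_two u]
      _ = 2 * u ^ (-(1 / 2) : ℝ) := by
          rw [mul_left_comm, ← rpow_add hu]
          norm_num
  · have hu0 : 0 < u := by linarith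
    have hc : 0 ≤ 1 - cos u := by linarith [cos_le_one u]
    rw [abs_of_nonneg (by positivity), mul_comm]
    gcongr
    · linarith [neg_one_le_cos u]
    · exact hu.le
    · norm_num

theorem integrableOn_rpow_mul_sinc :
    IntegrableOn (fun u : ℝ => u ^ (-(1 / 2) : ℝ) * sinc u) (Set.Ioi 0) := by
  have hm : Measurable sinc := continuous_sinc.measurable
  refine integrableOn_Ioi_of_rpow_bounds (C := 1) (by fun_prop) (fun u hu hu1 => ?_) (fun u hu => ?_)
  · rw [abs_mul, abs_of_nonneg (by positivity), one_mul]
    exact mul_le_of_le_one_right (by positivity) (abs_sinc_le_one _)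
  · have hu0 : 0 < u := by linarith
    rw [abs_mul, abs_of_nonneg (by positivity), one_mul]
    calc u ^ (-(1 / 2) : ℝ) * |sinc u| ≤ u ^ (-(1 / 2) : ℝ) * u ^ (-1 : ℝ) := by
          gcongr
          rw [sinc_of_ne_zero hu0.ne', abs_div, abs_of_pos hu0, rpow_neg_one, ← one_div]
          gcongr
          exact abs_sin_le_one u
      _ = u ^ (-(3 / 2) : ℝ) := by rw [← rpow_add hu0]; norm_num
      _ ≤ _ := rpow_le_rpow_of_exponent_le hu.le (by norm_num)

/-- A fractional moment of the cardinal sine. -/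
noncomputable def sincMoment : ℝ := ∫ u in Set.Ioi (0 : ℝ), u ^ (-(1 / 2) : ℝ) * sinc u

/-- Integration by parts with the primitive `1 - cos u` of `sin u`, which kills the boundary term at
0 and makes the new integrand nonnegative, hence the moment positive. -/
theorem sincMoment_eq :
    sincMoment = 3 / 2 * ∫ u in Set.Ioi (0 : ℝ), u ^ (-(5 / 2) : ℝ) * (1 - cos u) := by
  have hder : ∀ u ∈ Set.Ioi (0 : ℝ), HasDerivAt (fun u : ℝ => u ^ (-(3 / 2) : ℝ) * (1 - cos u))
      (u ^ (-(1 / 2) : ℝ) * sinc u - 3 / 2 * (u ^ (-(5 / 2) : ℝ) * (1 - cos u))) u := by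
    intro u hu
    have hu0 : (0 : ℝ) < u := hu
    have h1 := hasDerivAt_rpow_const (x := u) (p := -(3 / 2)) (Or.inl hu0.ne')
    have h2 := (hasDerivAt_cos u).const_sub 1
    refine (h1.mul h2).congr_deriv ?_
    rw [sinc_of_ne_zero hu0.ne', show (-(3 / 2) - 1 : ℝ) = -(5 / 2) by norm_num,
      show (-(1 / 2) : ℝ) = -(3 / 2) + 1 by norm_num, rpow_add hu0, rpow_one]
    field_simp
    ring
  have hbd : ∀ u : ℝ, 0 ≤ u → |u ^ (-(3 / 2) : ℝ) * (1 - cos u)| ≤ u ^ (1 / 2 : ℝ) := by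
    intro u hu
    rcases hu.eq_or_lt with rfl | hu0
    · simp
    have hc : 0 ≤ 1 - cos u := by linarith [cos_le_one u]
    rw [abs_of_nonneg (by positivity)]
    calc u ^ (-(3 / 2) : ℝ) * (1 - cos u) ≤ u ^ (-(3 / 2) : ℝ) * u ^ (2 : ℝ) := by
          rw [rpow_two]
          gcongr
          nlinarith [one_sub_cos_le_sq_div_two u]
      _ = _ := by rw [← rpow_add hu0]; norm_num
  have hcont : ContinuousWithinAt (fun u : ℝ => u ^ (-(3 / 2) : ℝ) * (1 - cos u)) (Set.Ici 0) 0 := by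
    rw [ContinuousWithinAt]
    simp only [cos_zero, sub_self, mul_zero]
    refine squeeze_zero_norm' (a := fun u : ℝ => u ^ (1 / 2 : ℝ)) ?_ ?_
    · filter_upwards [self_mem_nhdsWithin] with u hu using hbd u hu
    · have h : ContinuousAt (fun u : ℝ => u ^ (1 / 2 : ℝ)) 0 :=
        continuousAt_rpow_const _ _ (Or.inr (by norm_num))
      have h2 := h.tendsto
      rw [zero_rpow (by norm_num)] at h2
      exact h2.mono_left nhdsWithin_le_nhds
  have hlim : Tendsto (fun u : ℝ => u ^ (-(3 / 2) : ℝ) * (1 - cos u)) atTop (𝓝 0) := by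
    refine squeeze_zero_norm' (a := fun u : ℝ => u ^ (-(3 / 2) : ℝ) * 2) ?_ ?_
    · filter_upwards [eventually_gt_atTop 0] with u hu
      have hc : 0 ≤ 1 - cos u := by linarith [cos_le_one u]
      rw [norm_of_nonneg (by positivity)]
      gcongr
      linarith [neg_one_le_cos u]
    · simpa using (tendsto_rpow_neg_atTop (by norm_num : (0 : ℝ) < 3 / 2)).mul_const 2
  have hH := integrableOn_rpow_mul_one_sub_cos.const_mul (3 / 2)
  have h := integral_Ioi_of_hasDerivAt_of_tendsto hcont hder
    (integrableOn_rpow_mul_sinc.sub hH) hlim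
  rw [integral_sub integrableOn_rpow_mul_sinc hH, integral_const_mul] at h
  simp only [cos_zero, sub_self, mul_zero] at h
  exact sub_eq_zero.1 h

theorem sincMoment_pos : 0 < sincMoment := by
  rw [sincMoment_eq]
  refine mul_pos (by norm_num) ?_
  rw [setIntegral_pos_iff_support_of_nonneg_ae
    (ae_restrict_of_forall_mem measurableSet_Ioi fun u hu => ?_) integrableOn_rpow_mul_one_sub_cos]
  · refine lt_of_lt_of_le (b := volume (Set.Ioo (0 : ℝ) 1)) (by simp) (measure_mono ?_)
    intro u hu
    refine ⟨?_, hu.1⟩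
    have h1 : cos u < 1 := by
      have := cos_lt_cos_of_nonneg_of_le_pi le_rfl (by linarith [hu.2, pi_gt_three]) hu.1
      rwa [cos_zero] at this
    have h2 := rpow_pos_of_pos hu.1 (-(5 / 2))
    exact (mul_pos h2 (by linarith)).ne'
  · have hu0 : (0 : ℝ) < u := hu
    have hc : 0 ≤ 1 - cos u := by linarith [cos_le_one u]
    simp only [Pi.zero_apply]
    positivity

/-! ### The singular profile and its rescaled limit -/

theorem one_le_one_sub_log {θ : ℝ} (h0 : 0 < θ) (h1 : θ ≤ 1) : 1 ≤ 1 - log θ := by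
  linarith [log_nonpos h0.le h1]

theorem integrableOn_one_sub_log_rpow {δ : ℝ} (hδ : 1 / 2 < δ) :
    IntegrableOn (fun θ : ℝ => (1 - log θ) ^ (-(2 * δ)) * θ⁻¹) (Set.Ioc 0 1) := by
  -- A primitive that tends to 0 at 0 because `δ > 1/2`. Since `log 0 = 0`, the formula has the
  -- wrong value there and is corrected to be continuous.
  set g : ℝ → ℝ := Function.update (fun θ => (1 - log θ) ^ (-(2 * δ - 1)) / (2 * δ - 1)) 0 0 with hg
  have hpos : 0 < 2 * δ - 1 := by linarith
  have hne : ∀ θ : ℝ, θ ≠ 0 → g θ = (1 - log θ) ^ (-(2 * δ - 1)) / (2 * δ - 1) := fun θ h => by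
    rw [hg, Function.update_of_ne h]
  have hder : ∀ θ : ℝ, 0 < θ → θ ≤ 1 →
      HasDerivAt g ((1 - log θ) ^ (-(2 * δ)) * θ⁻¹) θ := by
    intro θ h0 h1
    have hl := one_le_one_sub_log h0 h1
    have h2 := (((hasDerivAt_log h0.ne').const_sub 1).rpow_const (p := -(2 * δ - 1))
      (Or.inl (by linarith))).div_const (2 * δ - 1)
    refine (h2.congr_deriv ?_).congr_of_eventuallyEq ?_
    · rw [show -(2 * δ - 1) - 1 = -(2 * δ) by ring]
      field_simp
    · filter_upwards [lt_mem_nhds h0] with y hy using hne y hy.ne'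
  refine intervalIntegral.integrableOn_deriv_of_nonneg (g := g) ?_ (fun θ h => hder θ h.1 h.2.le) (fun θ h => ?_)
  · intro θ h
    rcases h.1.eq_or_lt with rfl | h0
    · have h3 : g 0 = 0 := by simp [hg]
      have hw : Tendsto g (𝓝[>] 0) (𝓝 0) := by
        have h4 : Tendsto (fun θ : ℝ => 1 - log θ) (𝓝[>] 0) atTop := by
          have := tendsto_neg_atBot_atTop.comp tendsto_log_nhdsGT_zero
          simpa [sub_eq_add_neg] using tendsto_atTop_add_const_left _ 1 this
        have h5 := ((tendsto_rpow_neg_atTop hpos).comp h4).div_const (2 * δ - 1)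
        rw [zero_div] at h5
        refine h5.congr' ?_
        filter_upwards [self_mem_nhdsWithin] with y hy
        rw [hne y (ne_of_gt hy)]
        rfl
      have : ContinuousWithinAt g (Set.Ioi 0) 0 := by rwa [ContinuousWithinAt, h3]
      exact (continuousWithinAt_Ioi_iff_Ici.1 this).mono fun y hy => hy.1
    · exact (hder θ h0 h.2).continuousAt.continuousWithinAt
  · have := one_le_one_sub_log h.1 h.2.le
    have := h.1
    positivity

/-- A square integrable spectral profile with a logarithmically damped inverse square root
singularity at the bottom of the band. -/
noncomputable def singularProfile (δ : ℝ) : ℝ → ℝ :=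
  (Set.Ioc (0 : ℝ) 1).indicator fun θ => θ ^ (-(1 / 2) : ℝ) * (1 - log θ) ^ (-δ)

theorem measurable_singularProfile (δ : ℝ) : Measurable (singularProfile δ) := by
  refine Measurable.indicator ?_ measurableSet_Ioc
  have := measurable_log
  fun_prop

theorem memLp_singularProfile {δ : ℝ} (hδ : 1 / 2 < δ) :
    MemLp (singularProfile δ) 2 bandMeasure := by
  rw [memLp_two_iff_integrable_sq (measurable_singularProfile δ).aestronglyMeasurable]
  have h : Integrable (fun θ => singularProfile δ θ ^ 2) volume := by
    refine ((integrable_indicator_iff measurableSet_Ioc).2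
      (integrableOn_one_sub_log_rpow hδ)).congr (Eventually.of_forall fun θ => ?_)
    unfold singularProfile
    by_cases h : θ ∈ Set.Ioc (0 : ℝ) 1
    · have hl := one_le_one_sub_log h.1 h.2
      simp only [Set.indicator_of_mem h]
      rw [mul_pow, ← rpow_mul_natCast h.1.le, ← rpow_mul_natCast (by linarith)]
      norm_num
      rw [rpow_neg_one, mul_comm, mul_comm δ]
    · simp only [Set.indicator_of_notMem h]
      norm_num
  exact h.mono_measure Measure.restrict_le_self

/-- The rescaled spectral integrand of the particle at the origin. -/
noncomputable def rescaledIntegrand (δ ω₁ t u : ℝ) : ℝ :=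
  (Set.Iic (2 * ω₁ * t)).indicator (fun u => u ^ (-(1 / 2) : ℝ) *
    (log t / (1 - log (u / (2 * ω₁ * t)))) ^ δ *
      sinc (2 * ω₁ * t * sin (u / (2 * ω₁ * t)))) u

/-- Substitute `u = 2ω₁tθ`. The profile vanishes beyond 1, inside the band, so the integral may be
taken over the half-line. -/
theorem integral_singularProfile_mul_positionSymbol {δ ω₁ t : ℝ} (hω₁ : 0 < ω₁) (ht : 1 < t) :
    cosCoeff (fun θ => singularProfile δ θ * positionSymbol ω₁ t θ) 0 / √t * log t ^ δ
      = 1 / √(2 * ω₁) * ∫ u in Set.Ioi 0, rescaledIntegrand δ ω₁ t u := by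
  have ht0 : 0 < t := by linarith
  set x := 2 * ω₁ * t with hx
  have hx0 : 0 < x := by positivity
  have hlt : 0 < log t := log_pos ht
  have h1 : cosCoeff (fun θ => singularProfile δ θ * positionSymbol ω₁ t θ) 0
      = ∫ θ in Set.Ioi 0, singularProfile δ θ * positionSymbol ω₁ t θ := by
    rw [cosCoeff, bandMeasure]
    simp only [Int.cast_zero, mul_zero, zero_mul, cos_zero, mul_one]
    refine (setIntegral_eq_of_subset_of_forall_sdiff_eq_zero measurableSet_Ioi
      (fun θ h => h.1) fun θ h => ?_).symm
    have : θ ∉ Set.Ioc (0 : ℝ) 1 := fun h' =>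
      h.2 ⟨h.1, by linarith [h'.2, pi_gt_three]⟩
    rw [singularProfile, Set.indicator_of_notMem this, zero_mul]
  have h2 := integral_comp_mul_left_Ioi
    (fun θ => singularProfile δ θ * positionSymbol ω₁ t θ) 0 (inv_pos.2 hx0)
  rw [mul_zero, inv_inv, smul_eq_mul, ← h1] at h2
  have h3 : ∀ u ∈ Set.Ioi (0 : ℝ),
      singularProfile δ (x⁻¹ * u) * positionSymbol ω₁ t (x⁻¹ * u)
        = t * √x * (log t ^ δ)⁻¹ * rescaledIntegrand δ ω₁ t u := by
    intro u hu
    have hu0 : (0 : ℝ) < u := hu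
    unfold rescaledIntegrand
    rw [← hx]
    by_cases hux : u ≤ x
    · have hmem : x⁻¹ * u ∈ Set.Ioc (0 : ℝ) 1 :=
        ⟨by positivity, by rw [inv_mul_le_iff₀ hx0]; linarith⟩
      have hl := one_le_one_sub_log hmem.1 hmem.2
      rw [Set.indicator_of_mem (show u ∈ Set.Iic x from hux), singularProfile,
        Set.indicator_of_mem hmem, positionSymbol, dispersion,
        show t * (2 * ω₁ * sin (x⁻¹ * u)) = x * sin (x⁻¹ * u) by rw [hx]; ring,
        show u / x = x⁻¹ * u by rw [div_eq_inv_mul], div_rpow hlt.le (by linarith),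
        mul_rpow (by positivity) hu0.le, inv_rpow hx0.le, ← rpow_neg hx0.le, neg_neg,
        ← sqrt_eq_rpow, rpow_neg (by linarith : 0 ≤ 1 - log (x⁻¹ * u))]
      have : (log t) ^ δ ≠ 0 := (rpow_pos_of_pos hlt δ).ne'
      have : (1 - log (x⁻¹ * u)) ^ δ ≠ 0 := (rpow_pos_of_pos (by linarith) δ).ne'
      field_simp
    · have hmem : x⁻¹ * u ∉ Set.Ioc (0 : ℝ) 1 := fun h => hux (by
        have := h.2
        rw [inv_mul_le_iff₀ hx0] at this
        linarith)
      rw [Set.indicator_of_notMem (show u ∉ Set.Iic x from hux), singularProfile,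
        Set.indicator_of_notMem hmem]
      simp
  rw [setIntegral_congr_fun measurableSet_Ioi h3, integral_const_mul] at h2
  have h4 : cosCoeff (fun θ => singularProfile δ θ * positionSymbol ω₁ t θ) 0
      = x⁻¹ * (t * √x * (log t ^ δ)⁻¹ * ∫ u in Set.Ioi 0, rescaledIntegrand δ ω₁ t u) := by
    rw [h2]; field_simp
  rw [h4]
  have e1 : (log t) ^ δ ≠ 0 := (rpow_pos_of_pos hlt δ).ne'
  have e2 : √x = √(2 * ω₁) * √t := by rw [hx, sqrt_mul (by positivity)]
  have e3 : x = √(2 * ω₁) ^ 2 * √t ^ 2 := by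
    rw [sq_sqrt (by positivity), sq_sqrt ht0.le]
  have e4 : t = √t ^ 2 := (sq_sqrt ht0.le).symm
  have e5 : √t ≠ 0 := (sqrt_pos.2 ht0).ne'
  have e6 : √(2 * ω₁) ≠ 0 := (sqrt_pos.2 (by positivity)).ne'
  generalize (∫ u in Set.Ioi 0, rescaledIntegrand δ ω₁ t u) = I
  generalize (log t) ^ δ = l at e1 ⊢
  rw [e2, e3]
  have : t * (√(2 * ω₁) * √t) = √t ^ 2 * (√(2 * ω₁) * √t) := by rw [← e4]
  rw [this]
  field_simp

/-- Jordan's inequality gives `x sin (u/x) ≥ u/2`, used for `u ≥ 2`; for smaller `u` the bound 1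
suffices. -/
theorem abs_sinc_mul_sin_le {x u : ℝ} (hu : 0 < u) (hux : u ≤ x) :
    |sinc (x * sin (u / x))| ≤ 3 / (1 + u) := by
  have hx : 0 < x := by linarith
  have hv : u / x ≤ 1 := by rw [div_le_one hx]; exact hux
  have hv0 : 0 < u / x := by positivity
  rcases le_total u 2 with h | h
  · refine (abs_sinc_le_one _).trans ?_
    rw [le_div_iff₀ (by linarith)]; linarith
  · have h1 := mul_le_sin hv0.le (by linarith [pi_gt_three])
    have h2 : u / 2 ≤ x * sin (u / x) := by
      calc u / 2 ≤ x * (2 / π * (u / x)) := by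
            rw [show x * (2 / π * (u / x)) = u * (2 / π) by field_simp]
            have : 1 / 2 ≤ 2 / π := by
              rw [div_le_div_iff₀ two_pos pi_pos]; linarith [pi_le_four]
            nlinarith
        _ ≤ _ := by gcongr
    have h3 : 0 < x * sin (u / x) := by linarith
    calc _ ≤ |x * sin (u / x)|⁻¹ := by
          rw [sinc_of_ne_zero h3.ne', abs_div, ← one_div]
          gcongr
          exact abs_sin_le_one _
      _ = (x * sin (u / x))⁻¹ := by rw [abs_of_pos h3]
      _ ≤ (u / 2)⁻¹ := by gcongr
      _ ≤ _ := by
          rw [inv_div, div_le_div_iff₀ hu (by linarith)]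
          linarith

/-- The denominator is at least 1 and differs from `log t` by `1 + log (2ω₁) - log u`, so the ratio
is at most `1 + |log (2ω₁)| + log (1 + u)`. Bounding the last logarithm by a power `1/(4δ)` leaves
growth `1/4` after raising to `δ`. -/
theorem log_div_rpow_le {δ ω₁ t u : ℝ} (hδ : 0 < δ) (hω₁ : 0 < ω₁) (ht : 1 < t) (hu : 0 < u)
    (hut : u ≤ 2 * ω₁ * t) :
    (log t / (1 - log (u / (2 * ω₁ * t)))) ^ δ
      ≤ (1 + |log (2 * ω₁)| + 4 * δ) ^ δ * (1 + u) ^ (1 / 4 : ℝ) := by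
  have ht0 : 0 < t := by linarith
  have hx0 : 0 < 2 * ω₁ * t := by positivity
  have hD := one_le_one_sub_log (div_pos hu hx0) (by rw [div_le_one hx0]; exact hut)
  have hlog : log (u / (2 * ω₁ * t)) = log u - (log (2 * ω₁) + log t) := by
    rw [log_div hu.ne' hx0.ne', log_mul (by positivity) ht0.ne']
  have hu1 : log u ≤ log (1 + u) := log_le_log hu (by linarith)
  have hu2 : 0 ≤ log (1 + u) := log_nonneg (by linarith)
  have hε : (0 : ℝ) < 1 / (4 * δ) := by positivity
  have hb := log_le_rpow_div (x := 1 + u) (by linarith) hε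
  have h1u : (1 : ℝ) ≤ (1 + u) ^ (1 / (4 * δ)) := one_le_rpow (by linarith) hε.le
  have hlt := log_pos ht
  have habs := neg_abs_le (log (2 * ω₁))
  have habs0 := abs_nonneg (log (2 * ω₁))
  have hratio : log t / (1 - log (u / (2 * ω₁ * t)))
      ≤ (1 + |log (2 * ω₁)| + 4 * δ) * (1 + u) ^ (1 / (4 * δ)) := by
    have s1 : log t / (1 - log (u / (2 * ω₁ * t))) ≤ 1 + |log (2 * ω₁)| + log (1 + u) := by
      rw [div_le_iff₀ (by linarith)]
      have : log t ≤ (1 - log (u / (2 * ω₁ * t))) + (|log (2 * ω₁)| + log (1 + u)) := by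
        rw [hlog]; linarith
      nlinarith [mul_nonneg (add_nonneg habs0 hu2) (sub_nonneg.2 hD)]
    rw [div_div_eq_mul_div, div_one] at hb
    nlinarith [mul_nonneg habs0 (sub_nonneg.2 h1u)]
  calc _ ≤ ((1 + |log (2 * ω₁)| + 4 * δ) * (1 + u) ^ (1 / (4 * δ))) ^ δ :=
        rpow_le_rpow (div_nonneg hlt.le (by linarith)) hratio hδ.le
    _ = _ := by
        rw [mul_rpow (by positivity) (by positivity), ← rpow_mul (by linarith)]
        congr 2
        field_simp

theorem abs_rescaledIntegrand_le {δ ω₁ t u : ℝ} (hδ : 0 < δ) (hω₁ : 0 < ω₁) (ht : 1 < t)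
    (hu : 0 < u) :
    |rescaledIntegrand δ ω₁ t u| ≤ (1 + |log (2 * ω₁)| + 4 * δ) ^ δ * 3 *
      (u ^ (-(1 / 2) : ℝ) * (1 + u) ^ (-(3 / 4) : ℝ)) := by
  unfold rescaledIntegrand
  by_cases hut : u ∈ Set.Iic (2 * ω₁ * t)
  · have hx0 : 0 < 2 * ω₁ * t := by positivity
    have hD := one_le_one_sub_log (div_pos hu hx0) (by rw [div_le_one hx0]; exact hut)
    have hR : 0 ≤ (log t / (1 - log (u / (2 * ω₁ * t)))) ^ δ :=
      rpow_nonneg (div_nonneg (log_pos ht).le (by linarith)) _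
    rw [Set.indicator_of_mem hut, abs_mul, abs_mul, abs_of_nonneg hR,
      abs_of_nonneg (by positivity : 0 ≤ u ^ (-(1 / 2) : ℝ))]
    calc _ ≤ u ^ (-(1 / 2) : ℝ) * ((1 + |log (2 * ω₁)| + 4 * δ) ^ δ * (1 + u) ^ (1 / 4 : ℝ))
          * (3 / (1 + u)) := by
          gcongr
          · exact log_div_rpow_le hδ hω₁ ht hu hut
          · exact abs_sinc_mul_sin_le hu hut
      _ = _ := by
          rw [show (-(3 / 4) : ℝ) = 1 / 4 + -1 by norm_num, rpow_add (by linarith : 0 < 1 + u),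
            rpow_neg_one]
          ring
  · rw [Set.indicator_of_notMem hut, abs_zero]
    positivity

theorem tendsto_rescaledIntegrand {δ ω₁ u : ℝ} (hω₁ : 0 < ω₁) (hu : 0 < u) :
    Tendsto (fun t => rescaledIntegrand δ ω₁ t u) atTop (𝓝 (u ^ (-(1 / 2) : ℝ) * sinc u)) := by
  have hxt : Tendsto (fun t : ℝ => 2 * ω₁ * t) atTop atTop :=
    tendsto_id.const_mul_atTop (by positivity)
  have hux : Tendsto (fun t : ℝ => u / (2 * ω₁ * t)) atTop (𝓝 0) := hxt.const_div_atTop u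
  have hsin : Tendsto (fun t : ℝ => 2 * ω₁ * t * sin (u / (2 * ω₁ * t))) atTop (𝓝 u) := by
    have h1 : Tendsto (fun t : ℝ => u * sinc (u / (2 * ω₁ * t))) atTop (𝓝 (u * sinc 0)) :=
      ((continuous_sinc.tendsto 0).comp hux).const_mul u
    rw [sinc_zero, mul_one] at h1
    refine h1.congr' ?_
    filter_upwards [eventually_gt_atTop 0] with t ht
    have : u / (2 * ω₁ * t) ≠ 0 := by positivity
    rw [sinc_of_ne_zero this]
    field_simp
  have hlog : Tendsto (fun t : ℝ => log t / (1 - log (u / (2 * ω₁ * t)))) atTop (𝓝 1) := by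
    have h1 : Tendsto (fun t : ℝ => 1 + (1 + log (2 * ω₁) - log u) / log t) atTop (𝓝 (1 + 0)) :=
      tendsto_const_nhds.add (tendsto_log_atTop.const_div_atTop _)
    have h2 := h1.inv₀ (by norm_num)
    norm_num at h2
    refine h2.congr' ?_
    filter_upwards [eventually_gt_atTop 1] with t ht
    have ht0 : 0 < t := by linarith
    have hl := log_pos ht
    rw [log_div hu.ne' (by positivity), log_mul (by positivity) ht0.ne',
      show 1 - (log u - (log (2 * ω₁) + log t)) = log t + (1 + log (2 * ω₁) - log u) by ring,
      ← inv_div]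
    field_simp
  have hpow := hlog.rpow_const (p := δ) (Or.inl one_ne_zero)
  rw [one_rpow] at hpow
  have hall := (hpow.const_mul (u ^ (-(1 / 2) : ℝ))).mul ((continuous_sinc.tendsto u).comp hsin)
  rw [mul_one] at hall
  refine hall.congr' ?_
  filter_upwards [hxt.eventually_ge_atTop u] with t ht
  rw [rescaledIntegrand, Set.indicator_of_mem (show u ∈ Set.Iic (2 * ω₁ * t) from ht)]
  rfl

theorem measurable_rescaledIntegrand (δ ω₁ t : ℝ) : Measurable (rescaledIntegrand δ ω₁ t) := by
  refine Measurable.indicator ?_ measurableSet_Iic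
  have h1 := measurable_log
  have h2 : Measurable sinc := continuous_sinc.measurable
  fun_prop

theorem tendsto_integral_rescaledIntegrand {δ ω₁ : ℝ} (hδ : 0 < δ) (hω₁ : 0 < ω₁) :
    Tendsto (fun t => ∫ u in Set.Ioi 0, rescaledIntegrand δ ω₁ t u) atTop (𝓝 sincMoment) := by
  refine tendsto_integral_filter_of_dominated_convergence _
    (Eventually.of_forall fun t => (measurable_rescaledIntegrand δ ω₁ t).aestronglyMeasurable) ?_
    (integrableOn_rpow_mul_one_add_rpow ((1 + |log (2 * ω₁)| + 4 * δ) ^ δ * 3)) ?_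
  · filter_upwards [eventually_gt_atTop 1] with t ht
    exact ae_restrict_of_forall_mem measurableSet_Ioi fun u hu =>
      abs_rescaledIntegrand_le hδ hω₁ ht hu
  · exact ae_restrict_of_forall_mem measurableSet_Ioi fun u hu => tendsto_rescaledIntegrand hω₁ hu

/-- The initial velocities with almost square root growth at the origin. -/
noncomputable def growthVelocity {δ : ℝ} (hδ : 1 / 2 < δ) : L2Z :=
  -- The bare profile has limit `sincMoment / √(2ω₁)`; the scalar replaces the moment by the
  -- prescribed `Γ(δ)`.
  (Gamma δ / sincMoment) • cosCoeffSeq 0 (singularProfile δ) (memLp_singularProfile hδ)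

theorem IsSolution.tendsto_growthVelocity {ω₁ δ : ℝ} (hω₁ : 0 < ω₁) (hδ : 1 / 2 < δ)
    {q p : ℝ → L2Z} (h : IsSolution 0 ω₁ q p) (hq : q 0 = 0) (hp : p 0 = growthVelocity hδ) :
    Tendsto (fun t : ℝ => q t 0 / √t * log t ^ δ) atTop (𝓝 (Gamma δ / √(2 * ω₁))) := by
  have h1 := ((tendsto_integral_rescaledIntegrand (by linarith : 0 < δ) hω₁).const_mul
    (1 / √(2 * ω₁))).const_mul (Gamma δ / sincMoment)
  have h2 : Gamma δ / sincMoment * (1 / √(2 * ω₁) * sincMoment) = Gamma δ / √(2 * ω₁) := by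
    have := sincMoment_pos.ne'
    field_simp
  rw [h2] at h1
  refine h1.congr' ?_
  filter_upwards [eventually_gt_atTop 1] with t ht
  have ht0 : 0 ≤ t := by linarith
  have h3 : q t 0 = Gamma δ / sincMoment *
      cosCoeff (fun θ => singularProfile δ θ * positionSymbol ω₁ t θ) 0 := by
    have h4 := h.eq_flow ht0
    have h5 := flow_cosCoeffSeq_fst hω₁ 0 (memLp_singularProfile hδ) ht0 0
    have h6 : ((0 : L2Z), growthVelocity hδ) = (Gamma δ / sincMoment) •
        ((0 : L2Z), cosCoeffSeq 0 (singularProfile δ) (memLp_singularProfile hδ)) := by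
      rw [Prod.smul_mk, smul_zero]; rfl
    rw [hq, hp, h6, map_smul] at h4
    rw [show q t = _ from congrArg Prod.fst h4, Prod.smul_fst, lp.coeFn_smul, Pi.smul_apply, h5,
      smul_eq_mul, sub_zero]
  rw [h3, ← integral_singularProfile_mul_positionSymbol hω₁ ht]
  ring

end Spectral

end HarmonicChain

theorem theorem1 (ω₁ : ℝ) (hω₁ : 0 < ω₁) :
    -- (1) a pinned chain is uniformly bounded in time and space
    (∀ ω₀ : ℝ, 0 < ω₀ → ∀ q p : ℝ → HarmonicChain.L2Z,
      HarmonicChain.IsSolution ω₀ ω₁ q p →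
        (⨆ t : ℝ, ⨆ _ : 0 ≤ t, HarmonicChain.maxNorm (q t)) < ⊤) ∧
    -- (2.a) the unpinned chain: square root bound
    (∀ q p : ℝ → HarmonicChain.L2Z, HarmonicChain.IsSolution 0 ω₁ q p →
      ∀ t : ℝ, 0 ≤ t →
        HarmonicChain.maxNorm (q t) ≤
          ENNReal.ofReal (2 / Real.sqrt ω₁ * ‖p 0‖ * Real.sqrt t + ‖q 0‖)) ∧
    -- (2.b) the unpinned chain: logarithmic bound
    (∀ q p : ℝ → HarmonicChain.L2Z, HarmonicChain.IsSolution 0 ω₁ q p →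
      Summable (fun k : {k : ℤ // k ≠ 0} => |p 0 k| * Real.log |((k : ℤ) : ℝ)|) →
        Summable (fun k : ℤ => p 0 k) ∧
        ∃ c : ℝ, 0 < c ∧ ∀ t : ℝ, 1 ≤ t →
          HarmonicChain.maxNorm (q t) ≤
            ENNReal.ofReal (Real.sqrt 2 / (ω₁ * Real.pi) * |∑' k : ℤ, p 0 k| * Real.log t
              + ‖q 0‖ + c)) ∧
    -- (2.c) the unpinned chain: initial data with almost square root growth
    (∀ δ : ℝ, 1 / 2 < δ → ∃ p₀ : HarmonicChain.L2Z,
      (∃ q p : ℝ → HarmonicChain.L2Z,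
        HarmonicChain.IsSolution 0 ω₁ q p ∧ q 0 = 0 ∧ p 0 = p₀) ∧
      (∀ q p : ℝ → HarmonicChain.L2Z,
        HarmonicChain.IsSolution 0 ω₁ q p → q 0 = 0 → p 0 = p₀ →
          Tendsto (fun t : ℝ => q t 0 / Real.sqrt t * Real.log t ^ δ) atTop
            (𝓝 (Real.Gamma δ / Real.sqrt (2 * ω₁)))) ∧
      0 < Real.Gamma δ / Real.sqrt (2 * ω₁)) := by
  refine ⟨fun ω₀ hω₀ q p h => h.iSup_maxNorm_lt_top hω₀, fun q p h t ht => h.maxNorm_le_sqrt hω₁ ht,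
    fun q p h hs => ?_, fun δ hδ => ⟨HarmonicChain.growthVelocity hδ, ?_, ?_, ?_⟩⟩
  · have hs' := HarmonicChain.summable_abs_mul_log hs
    exact ⟨(HarmonicChain.summable_abs_of_summable_abs_mul_log hs').of_abs,
      h.maxNorm_le_log hω₁ hs'⟩
  · exact ⟨_, _, HarmonicChain.isSolution_flow 0 ω₁ (0, HarmonicChain.growthVelocity hδ),
      by simp, by simp⟩
  · exact fun q p h hq hp => h.tendsto_growthVelocity hω₁ hδ hq hp
  · exact div_pos (Real.Gamma_pos_of_pos (by linarith)) (Real.sqrt_pos.2 (by linarith))
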